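/- **Conventions.** A graph means a finite multigraph (loops and multiple edges allowed) in Serre's formalism: finite sets $V_X$ of vertices and $\mathbb{E}_X$ of oriented edges, a fixed-point-free involution $e \mapsto \overline{e}$ of $\mathbb{E}_X$, and maps $s,t : \mathbb{E}_X \to V_X$ with $s(\overline e)=t(e)$ and $t(\overline e)=s(e)$. A bouquet is a graph with exactly one vertex. An unramified covering $Y \to X$ is a morphism of graphs that is surjective on vertices and that, for each vertex $v$ of $Y$, maps the edges starting at $v$ bijectively onto the edges starting at the image of $v$. For connected $Y$ and $X$ it is Galois with group $G$ if the group of automorphisms of $Y$ over $X$ acts transitively on the fibres and is isomorphic to $G$. For a prime $p$, an unramified $\mathbb{Z}_p$-covering $X_\infty/X$ of connected graphs is a tower of unramified coverings $$X = X_0 \leftarrow X_1 \leftarrow X_2 \leftarrow \cdots$$ of connected graphs such that, for every $n \ge 0$, the composite $X_n \to X$ is Galois with group isomorphic to $\mathbb{Z}/p^n\mathbb{Z}$. Let $\kappa_{X_n}$ be the number of spanning trees of $X_n$. The Iwasawa invariants $\lambda(X_\infty/X)$ and $\mu(X_\infty/X)$ are the (unique) non-negative integers for which there is an integer $\nu$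 with $$\operatorname{ord}_p(\kappa_{X_n}) = \lambda(X_\infty/X)\, n + \mu(X_\infty/X)\, p^n + \nu \qquad \text{for all sufficiently large } n.$$ **Theorem.** Let $p$ be a prime number. For every odd integer $\lambda \ge 1$ and every integer $\mu \ge 0$, there exists an unramified $\mathbb{Z}_p$-covering $X_\infty/X$ of connected graphs, with $X$ a bouquet, such that $\lambda(X_\infty/X) = \lambda$ and $\mu(X_\infty/X) = \mu$. -/

import Mathlib

/-- A finite multigraph in Serre's formalism: finite sets of vertices and of oriented edges, a
fixed-point-free involution reversing the orientation, and the source and target maps.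
Loops and multiple edges are allowed. -/
structure SerreGraph where
  /-- the vertices -/
  V : Type
  /-- the oriented edges -/
  E : Type
  finite_V : Finite V
  finite_E : Finite E
  /-- orientation reversal -/
  bar : E → E
  /-- source -/
  s : E → V
  /-- target -/
  t : E → V
  bar_bar : ∀ e, bar (bar e) = e
  bar_ne : ∀ e, bar e ≠ e
  s_bar : ∀ e, s (bar e) = t e
  t_bar : ∀ e, t (bar e) = s e

namespace SerreGraph

/-- The spanning subgraph with all the vertices of `X` and with edge set `F` is connected:
it is non-empty and any two vertices are joined by a path of edges in `F`. -/
def ConnectedOn (X : SerreGraph) (F : Set X.E) : Prop :=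
  Nonempty X.V ∧
    ∀ v w : X.V, Relation.ReflTransGen (fun a b => ∃ e ∈ F, X.s e = a ∧ X.t e = b) v w

/-- The graph `X` is connected. -/
def Connected (X : SerreGraph) : Prop := X.ConnectedOn Set.univ

/-- There is no cycle with edges in `F`. A cycle of length `k + 1` is a cyclic sequence of edges,
the target of each being the source of the next, which visits pairwise distinct vertices and never
uses both an edge and its opposite. (Addition in `Fin (k + 1)` is cyclic; a loop is a cycle of
length one.) -/
def AcyclicOn (X : SerreGraph) (F : Set X.E) : Prop :=
  ¬ ∃ (k : ℕ) (c : Fin (k + 1) → X.E),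
    (∀ i, c i ∈ F) ∧
    (∀ i, X.t (c i) = X.s (c (i + 1))) ∧
    (Function.Injective fun i => X.s (c i)) ∧
    (∀ i j, X.bar (c i) ≠ c j)

/-- `F` is the edge set of a spanning tree of `X`. -/
structure IsSpanningTree (X : SerreGraph) (F : Set X.E) : Prop where
  bar_mem : ∀ e ∈ F, X.bar e ∈ F
  connected : X.ConnectedOn F
  acyclic : X.AcyclicOn F

/-- The number of spanning trees of `X`. -/
noncomputable def numSpanningTrees (X : SerreGraph) : ℕ :=
  Nat.card {F : Set X.E // X.IsSpanningTree F}

/-- A bouquet is a graph with exactly one vertex. -/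
def IsBouquet (X : SerreGraph) : Prop := Nat.card X.V = 1

/-- A morphism of graphs. -/
structure Hom (Y X : SerreGraph) where
  /-- the map on vertices -/
  onV : Y.V → X.V
  /-- the map on edges -/
  onE : Y.E → X.E
  onE_bar : ∀ e, onE (Y.bar e) = X.bar (onE e)
  s_onE : ∀ e, X.s (onE e) = onV (Y.s e)
  t_onE : ∀ e, X.t (onE e) = onV (Y.t e)

namespace Hom

/-- The identity morphism. -/
def id (X : SerreGraph) : Hom X X where
  onV := fun v => v
  onE := fun e => e
  onE_bar := fun _ => rfl
  s_onE := fun _ => rfl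
  t_onE := fun _ => rfl

/-- Composition of morphisms, `Z → Y → X`. -/
def comp {Z Y X : SerreGraph} (f : Hom Y X) (g : Hom Z Y) : Hom Z X where
  onV := fun v => f.onV (g.onV v)
  onE := fun e => f.onE (g.onE e)
  onE_bar := fun e => by rw [g.onE_bar, f.onE_bar]
  s_onE := fun e => by rw [f.s_onE, g.s_onE]
  t_onE := fun e => by rw [f.t_onE, g.t_onE]

/-- An (unramified) covering: surjective on vertices, and for every vertex `v` of `Y` a bijection
from the edges starting at `v` onto the edges starting at the image of `v`. -/
def IsCovering {Y X : SerreGraph} (f : Hom Y X) : Prop :=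
  Function.Surjective f.onV ∧
    ∀ v : Y.V, Set.BijOn f.onE {e | Y.s e = v} {e | X.s e = f.onV v}

/-- The group of automorphisms of the graph `Y` over `X` (deck transformations), as a group of
pairs of a permutation of the vertices and a permutation of the edges.
(Compatibility with targets follows from that with sources and with orientation reversal.) -/
def deckGroup {Y X : SerreGraph} (f : Hom Y X) :
    Subgroup (Equiv.Perm Y.V × Equiv.Perm Y.E) where
  carrier := {σ |
    (∀ e, σ.2 (Y.bar e) = Y.bar (σ.2 e)) ∧ (∀ e, Y.s (σ.2 e) = σ.1 (Y.s e)) ∧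
    (∀ v, f.onV (σ.1 v) = f.onV v) ∧ (∀ e, f.onE (σ.2 e) = f.onE e)}
  one_mem' := by simp
  mul_mem' := by
    rintro a b ⟨a1, a2, a3, a4⟩ ⟨b1, b2, b3, b4⟩
    simp [a1, a2, a3, a4, b1, b2, b3, b4]
  inv_mem' := by
    rintro a ⟨a1, a2, a3, a4⟩
    refine ⟨fun e => ?_, fun e => ?_, fun v => ?_, fun e => ?_⟩
    · apply a.2.injective
      simp [a1]
    · apply a.1.injective
      simp [← a2]
    · have := a3 (a.1⁻¹ v)
      simpa using this.symm
    · have := a4 (a.2⁻¹ e)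
      simpa using this.symm

/-- `f : Y → X` is an (unramified) Galois covering with Galois group isomorphic to `G`: it is a
covering, the deck transformations act transitively on each fibre, and they form a group
isomorphic to `G`. (Meant for connected `Y` and `X`.) -/
def IsGaloisCovering {Y X : SerreGraph} (f : Hom Y X) (G : Type) [Group G] : Prop :=
  f.IsCovering ∧
    (∀ v w : Y.V, f.onV v = f.onV w → ∃ σ ∈ f.deckGroup, σ.1 v = w) ∧
    Nonempty (f.deckGroup ≃* G)

end Hom

end SerreGraph

/-- A tower of graphs `X₀ ← X₁ ← X₂ ← ⋯`; its base is `X₀`. -/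
structure GraphTower where
  /-- the `n`-th layer -/
  X : ℕ → SerreGraph
  /-- the transition morphisms -/
  proj : ∀ n, SerreGraph.Hom (X (n + 1)) (X n)

namespace GraphTower

/-- The composite `Xₙ → ⋯ → X₁ → X₀`. -/
def toBase (T : GraphTower) : ∀ n, SerreGraph.Hom (T.X n) (T.X 0)
  | 0 => SerreGraph.Hom.id (T.X 0)
  | n + 1 => (T.toBase n).comp (T.proj n)

/-- The tower is an unramified `ℤ_p`-covering of connected graphs: every layer is connected, the
transition morphisms are coverings, and `Xₙ → X₀` is a Galois covering with Galois group
isomorphic to `ℤ/pⁿℤ`. -/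
structure IsUnramifiedZpCovering (T : GraphTower) (p : ℕ) : Prop where
  connected : ∀ n, (T.X n).Connected
  covering : ∀ n, (T.proj n).IsCovering
  galois : ∀ n, (T.toBase n).IsGaloisCovering (Multiplicative (ZMod (p ^ n)))

/-- The Iwasawa invariants of the tower are `(lam, mu)`: for some integer `ν`, the number `κₙ` of
spanning trees of the `n`-th layer satisfies `ord_p κₙ = lam * n + mu * p ^ n + ν` for all
sufficiently large `n`. -/
def HasIwasawaInvariants (T : GraphTower) (p lam mu : ℕ) : Prop :=
  ∃ ν : ℤ, ∀ᶠ n : ℕ in Filter.atTop,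
    (padicValNat p (T.X n).numSpanningTrees : ℤ) = lam * n + mu * (p : ℤ) ^ n + ν

/-- The Iwasawa invariants are uniquely determined by the tower. -/
theorem HasIwasawaInvariants.unique {T : GraphTower} {p lam mu lam' mu' : ℕ} (hp : p.Prime)
    (h : T.HasIwasawaInvariants p lam mu) (h' : T.HasIwasawaInvariants p lam' mu') :
    lam = lam' ∧ mu = mu' := by
  obtain ⟨ν, h⟩ := h
  obtain ⟨ν', h'⟩ := h'
  obtain ⟨N, hN⟩ := Filter.eventually_atTop.1 (h.and h')
  have key : ∀ n, N ≤ n → (lam : ℤ) * n + mu * (p : ℤ) ^ n + ν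
      = lam' * n + mu' * (p : ℤ) ^ n + ν' := fun n hn => (hN n hn).1.symm.trans (hN n hn).2
  have e0 := key N le_rfl
  have e1 := key (N + 1) (by omega)
  have e2 := key (N + 2) (by omega)
  have hp1 : (p : ℤ) - 1 ≠ 0 := by have := hp.two_le; omega
  have hpN : (p : ℤ) ^ N ≠ 0 := pow_ne_zero _ (by exact_mod_cast hp.ne_zero)
  push_cast at e1 e2
  have hm : ((mu : ℤ) - mu') * ((p : ℤ) ^ N * ((p : ℤ) - 1) ^ 2) = 0 := by
    linear_combination e2 - 2 * e1 + e0
  have hm' : (mu : ℤ) = mu' := by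
    rcases mul_eq_zero.1 hm with h0 | h0
    · linarith
    · exact absurd h0 (mul_ne_zero hpN (pow_ne_zero _ hp1))
  rw [hm'] at e0 e1
  have hl : (lam : ℤ) = lam' := by linear_combination e1 - e0
  exact ⟨by exact_mod_cast hl, by exact_mod_cast hm'⟩

end GraphTower

/-! The layers are Cayley graphs of the groups `ℤ/pⁿ` for one fixed finite family of integers `α`,
one of them `1`. The bottom layer is then a bouquet, every layer is connected, and the deck
transformations are the translations (`isUnramifiedZpCovering_cayleyTower`). By the matrix-tree
theorem and the diagonalisation of the Laplacian by characters, `pⁿ κₙ` is the product of `∑ (2 - z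
^ a - z ^ (-a))` over the `pⁿ`-th roots of unity `z ≠ 1` (`card_mul_numSpanningTrees_cayley`).
Comparing two layers, `p κₙ₊₁ / κₙ` is the product over the primitive `pⁿ⁺¹`-th roots alone.

It remains to choose `α`. Only sums of terms `2 - z ^ a - z ^ (-a)` are available, but modulo `p` a
coefficient `-1` can be replaced by `p - 1`, and repetition yields `p ^ μ * ((2 - z - z⁻¹) ^ m + p *
y)` (`exists_laplaceSymbol_eq`). Here `2 - z - z⁻¹ = -z⁻¹ (1 - z)²`, while `p` is divisible by `(1 -
z) ^ φ(pⁿ⁺¹)`. For large `n` the first summand therefore dominates at a prime above `p`, and since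
`∏ (1 - z) = p`, the product over primitive roots has order `μ φ(pⁿ⁺¹) + 2m`
(`prod_laplaceSymbol_eq`). Thus `ord_p κₙ` grows by `μ (pⁿ⁺¹ - pⁿ) + 2m - 1` at each step, and `λ =
2m - 1` runs through the odd positive integers. -/

namespace Matrix

/-! ### Determinant identities: Cauchy–Binet and rank-one changes. -/

variable {n m R : Type*} [Fintype n] [DecidableEq n] [Fintype m] [CommRing R]

/-- Each row of `A * B` is a linear combination of rows of `B`, and the determinant is multilinear
in the rows. -/
theorem det_mul_eq_sum_fun (A : Matrix n m R) (B : Matrix m n R) :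
    (A * B).det = ∑ f : n → m, (∏ i, A i (f i)) * (B.submatrix f id).det := by
  have h : A * B = fun i => ∑ j, A i j • B j := by
    ext i k
    simp [Matrix.mul_apply]
  have := (detRowAlternating (n := n) (R := R)).toMultilinearMap.map_sum
    (fun i j => A i j • B j)
  rw [h]
  refine this.trans (Finset.sum_congr rfl fun f _ => ?_)
  exact (detRowAlternating (n := n) (R := R)).toMultilinearMap.map_smul_univ
    (fun i => A i (f i)) (fun i => B (f i))

/-- The functions with the image of the injective `f₀` are the `f₀ ∘ τ` with `τ` a permutation.
Reordering the rows of `B` contributes the sign of `τ`, and the signed products of entries of `A`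
add up to its minor. -/
theorem sum_fun_image_eq [DecidableEq m] (A : Matrix n m R) (B : Matrix m n R) {f₀ : n → m}
    (hf₀ : Function.Injective f₀) :
    ∑ f : n → m with Finset.univ.image f = Finset.univ.image f₀,
        (∏ i, A i (f i)) * (B.submatrix f id).det
      = (A.submatrix id f₀).det * (B.submatrix f₀ id).det := by
  have h : ∑ τ : Equiv.Perm n, (∏ i, A i (f₀ (τ i))) * (B.submatrix (f₀ ∘ τ) id).det
      = (A.submatrix id f₀).det * (B.submatrix f₀ id).det := by
    rw [← det_transpose (A.submatrix id f₀), det_apply', Finset.sum_mul]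
    refine Finset.sum_congr rfl fun τ _ => ?_
    have : B.submatrix (f₀ ∘ τ) id = (B.submatrix f₀ id).submatrix τ id := by
      ext; simp
    rw [this, det_permute]
    simp only [transpose_apply, submatrix_apply, id]
    ring
  rw [← h]
  symm
  refine Finset.sum_bij (fun τ _ => f₀ ∘ τ) ?_ ?_ ?_ fun _ _ => rfl
  · intro τ _
    simp only [Finset.mem_filter, Finset.mem_univ, true_and]
    ext x
    simp only [Finset.mem_image, Finset.mem_univ, true_and, Function.comp]
    exact ⟨fun ⟨a, ha⟩ => ⟨τ a, ha⟩, fun ⟨a, ha⟩ => ⟨τ.symm a, by simpa using ha⟩⟩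
  · intro τ _ τ' _ h
    ext i
    exact hf₀ (congrFun h i)
  · intro f hf
    simp only [Finset.mem_filter, Finset.mem_univ, true_and] at hf
    have hmem : ∀ i, ∃ j, f₀ j = f i := by
      intro i
      have : f i ∈ Finset.univ.image f₀ := hf ▸ Finset.mem_image_of_mem f (Finset.mem_univ i)
      simpa using this
    choose g hg using hmem
    have hsurj : Function.Surjective g := by
      intro j
      have : f₀ j ∈ Finset.univ.image f := hf ▸ Finset.mem_image_of_mem f₀ (Finset.mem_univ j)
      obtain ⟨i, -, hi⟩ := Finset.mem_image.1 this
      exact ⟨i, hf₀ ((hg i).trans hi)⟩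
    refine ⟨Equiv.ofBijective g (Finite.surjective_iff_bijective.1 hsurj), Finset.mem_univ _, ?_⟩
    ext i
    simp [hg]

/-- A form of the Cauchy–Binet formula for `det (A * Aᵀ)`. -/
theorem det_mul_transpose_eq_sum [DecidableEq m] (A : Matrix n m R) (c : Finset m → R)
    (hc : ∀ f : n → m, Function.Injective f →
      (A.submatrix id f).det ^ 2 = c (Finset.univ.image f)) :
    (A * Aᵀ).det = ∑ S ∈ Finset.powersetCard (Fintype.card n) Finset.univ, c S := by
  rw [det_mul_eq_sum_fun]
  have h0 : ∀ f : n → m, ¬ Function.Injective f → (Aᵀ.submatrix f id).det = 0 := by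
    intro f hf
    simp only [Function.Injective, not_forall] at hf
    obtain ⟨i, j, hij, hne⟩ := hf
    exact det_zero_of_row_eq hne (by ext k; simp [hij])
  rw [← Finset.sum_filter_of_ne (p := fun f : n → m => Function.Injective f)
    (fun f _ hf => by
      by_contra h
      exact hf (by rw [h0 f h, mul_zero]))]
  rw [← Finset.sum_fiberwise_of_maps_to (g := fun f : n → m => Finset.univ.image f)
    (t := Finset.powersetCard (Fintype.card n) Finset.univ)]
  · refine Finset.sum_congr rfl fun S hS => ?_
    rw [Finset.mem_powersetCard] at hS
    obtain ⟨e⟩ : Nonempty (n ≃ S) := Fintype.card_eq.1 (by simp [hS.2])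
    have hf₀ : Function.Injective fun i => (e i : m) :=
      Subtype.val_injective.comp e.injective
    have hS' : Finset.univ.image (fun i => (e i : m)) = S := by
      ext x
      simp only [Finset.mem_image, Finset.mem_univ, true_and]
      exact ⟨fun ⟨i, hi⟩ => hi ▸ (e i).2, fun hx => ⟨e.symm ⟨x, hx⟩, by simp⟩⟩
    have key := sum_fun_image_eq A Aᵀ hf₀
    rw [hS'] at key
    have hsq : (Aᵀ.submatrix (fun i => (e i : m)) id).det
        = (A.submatrix id fun i => (e i : m)).det := by
      rw [← det_transpose]; rfl
    rw [hsq, ← pow_two, hc _ hf₀, hS'] at key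
    rw [← key]
    refine Finset.sum_congr ?_ fun _ _ => rfl
    ext f
    simp only [Finset.mem_filter, Finset.mem_univ, true_and]
    refine ⟨fun h => h.2, fun h => ⟨?_, h⟩⟩
    have : (Finset.univ.image f).card = (Finset.univ : Finset n).card := by
      rw [h, hS.2, Finset.card_univ]
    exact Set.injOn_univ.1 (by simpa using Finset.card_image_iff.1 this)
  · intro f hf
    simp only [Finset.mem_filter, Finset.mem_univ, true_and] at hf
    rw [Finset.mem_powersetCard]
    exact ⟨Finset.subset_univ _, by rw [Finset.card_image_of_injective _ hf, Finset.card_univ]⟩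

/-- Adding the unit `e_r` to a diagonal entry of a matrix with zero row and column sums or adding
`1` to all its entries changes the determinant in comparable ways. -/
theorem card_sq_mul_det_add_single (L : Matrix n n R) (r : n)
    (hrow : ∀ i, ∑ j, L i j = 0) (hcol : ∀ j, ∑ i, L i j = 0) :
    (Fintype.card n : R) ^ 2 * (L + single r r 1).det = (L + of fun _ _ => 1).det := by
  let w : n → R := fun i => 1 - (Pi.single r 1 : n → R) i
  let U : Matrix n n R := 1 + vecMulVec (fun _ => 1) w
  let W : Matrix n n R := 1 + vecMulVec w (fun _ => 1)
  have hw : ∑ i, w i = Fintype.card n - 1 := by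
    simp [w, Finset.sum_sub_distrib]
  have hU : U.det = Fintype.card n := by
    have : U = 1 + replicateCol Unit (fun _ => (1 : R)) * replicateRow Unit w := by
      ext; simp [U, vecMulVec_apply, Matrix.mul_apply]
    rw [this, det_one_add_replicateCol_mul_replicateRow]
    simp [dotProduct, hw]
  have hW : W.det = Fintype.card n := by
    rw [← hU, ← det_transpose]
    congr 1
    ext i j
    simp [U, W, vecMulVec_apply, one_apply, eq_comm]
  -- Multiplying by `W` adds the sum of all rows to each row other than `r`. As the columns of `L`
  -- sum to zero, that sum is the unit row at `r`. Then `U` does the same to the columns.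
  have : W * (L + single r r 1) * U = L + of fun _ _ => 1 := by
    have h1 : W * (L + single r r 1) = L + of fun _ j => (Pi.single r 1 : n → R) j := by
      ext i j
      simp only [W, Matrix.add_mul, add_apply, vecMulVec_mul, vecMulVec_apply,
        vecMul, dotProduct, one_mul, of_apply, Finset.sum_add_distrib, hcol j]
      have : ∑ x, single r r (1 : R) x j = (Pi.single r 1 : n → R) j := by
        rw [Finset.sum_eq_single r]
        · by_cases h : r = j
          · subst h; simp
          · simp [h, Ne.symm h]
        · intro b _ hb; simp [Ne.symm hb]
        · simp
      rw [this]
      simp only [w, single_apply, Pi.single_apply]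
      by_cases h : r = i <;> by_cases h' : r = j <;> simp [h, h', eq_comm]
    rw [h1]
    ext i j
    simp only [U, Matrix.mul_add, add_apply, mul_vecMulVec, vecMulVec_apply,
      mulVec, dotProduct, mul_one, of_apply, Finset.sum_add_distrib, hrow i]
    simp [w]
  rw [← this, det_mul, det_mul, hU, hW]
  ring

end Matrix

/-! ### Paths, cycles and incidence vectors. -/

namespace SerreGraph

/-- A walk of minimal length visits pairwise distinct points. -/
theorem exists_injOn_chain {α : Type*} {R : α → α → Prop} {v w : α}
    (h : Relation.ReflTransGen R v w) :
    ∃ (k : ℕ) (x : ℕ → α), x 0 = v ∧ x k = w ∧ (∀ j < k, R (x j) (x (j + 1))) ∧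
      Set.InjOn x (Set.Iic k) := by
  classical
  have hex : ∃ (k : ℕ) (x : ℕ → α), x 0 = v ∧ x k = w ∧ ∀ j < k, R (x j) (x (j + 1)) := by
    induction h with
    | refl => exact ⟨0, fun _ => v, rfl, rfl, by simp⟩
    | @tail b c _ hbc ih =>
      obtain ⟨k, x, h0, hk, hx⟩ := ih
      refine ⟨k + 1, fun j => if j ≤ k then x j else c, by simp [h0], by simp, fun j hj => ?_⟩
      rcases Nat.lt_succ_iff_lt_or_eq.1 hj with h | rfl
      · simpa [h.le, Nat.succ_le_of_lt h] using hx j h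
      · simpa [hk] using hbc
  let k := Nat.find hex
  obtain ⟨x, h0, hk, hx⟩ := Nat.find_spec hex
  have key : ∀ i j, i < j → j ≤ k → x i ≠ x j := by
    intro i j hij hjk hxx
    -- A repetition `x i = x j` would allow the stretch between `i` and `j` to be cut out.
    refine Nat.find_min hex (m := k - (j - i)) (by omega)
      ⟨fun l => if l ≤ i then x l else x (l + (j - i)), by simp [h0], ?_, fun l hl => ?_⟩
    · by_cases h : k - (j - i) ≤ i
      · have h1 : k - (j - i) = i := by omega
        have h2 : j = k := by omega
        simp only [h1, le_refl, if_true]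
        rw [hxx, h2, hk]
      · simp only [h, if_false]
        rw [← hk]; congr 1; omega
    · rcases lt_trichotomy l i with h | rfl | h
      · simpa [h.le, Nat.succ_le_of_lt h] using hx l (by omega)
      · have := hx j (by omega)
        simp only [le_refl, if_true, hxx, Nat.not_succ_le_self, if_false]
        convert this using 2; omega
      · have := hx (l + (j - i)) (by omega)
        simp only [not_le.2 h, not_le.2 (Nat.lt_succ_of_lt h), if_false]
        convert this using 2; omega
  refine ⟨k, x, h0, hk, hx, fun i hi j hj hxx => ?_⟩
  rcases lt_trichotomy i j with h | h | h
  · exact absurd hxx (key i j h hj)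
  · exact h
  · exact absurd hxx.symm (key j i h hi)

/-- An edge whose end points are joined by a path avoiding it lies on a cycle. -/
theorem not_acyclicOn_of_path {X : SerreGraph} {F F' : Set X.E} (hF' : F' ⊆ F) {e₀ : X.E}
    (he₀ : e₀ ∈ F) (h₁ : X.bar e₀ ∉ F')
    (h : Relation.ReflTransGen (fun a b => ∃ e ∈ F', X.s e = a ∧ X.t e = b) (X.t e₀) (X.s e₀)) :
    ¬ X.AcyclicOn F := by
  obtain ⟨k, x, hx0, hxk, hx, hinj⟩ := exists_injOn_chain h
  have hx' : ∀ j, ∃ e, j < k → e ∈ F' ∧ X.s e = x j ∧ X.t e = x (j + 1) := by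
    intro j
    by_cases hj : j < k
    · obtain ⟨e, he⟩ := hx j hj
      exact ⟨e, fun _ => he⟩
    -- Beyond the end of the path `e₀` is only a default value.
    · exact ⟨e₀, fun h => absurd h hj⟩
  choose e he using hx'
  -- The edge `e₀` leads from the end of the path back to its start, so it takes the last place in
  -- the cycle.
  let c : Fin (k + 1) → X.E := fun i => if i = Fin.last k then e₀ else e i
  have hcl : c (Fin.last k) = e₀ := by simp [c]
  have hcn : ∀ i, i ≠ Fin.last k → c i = e i ∧ i.1 < k := by
    intro i hi
    exact ⟨by simp [c, hi], Fin.val_lt_last hi⟩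
  have hs : ∀ i, X.s (c i) = x i := by
    intro i
    by_cases hi : i = Fin.last k
    · rw [hi, hcl, Fin.val_last, hxk]
    · rw [(hcn i hi).1, (he i (hcn i hi).2).2.1]
  have ht : ∀ i, X.t (c i) = X.s (c (i + 1)) := by
    intro i
    rw [hs]
    by_cases hi : i = Fin.last k
    · rw [hi, hcl, Fin.last_add_one, Fin.val_zero, hx0]
    · rw [(hcn i hi).1, (he i (hcn i hi).2).2.2, Fin.val_add_one_of_lt (Fin.lt_last_iff_ne_last.2 hi)]
  have hsinj : Function.Injective fun i => X.s (c i) := by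
    intro i j hij
    simp only [hs] at hij
    exact Fin.ext (hinj (Nat.lt_succ_iff.1 i.2) (Nat.lt_succ_iff.1 j.2) hij)
  refine not_not.2 ⟨k, c, fun i => ?_, ht, hsinj, fun i j hij => ?_⟩
  · by_cases hi : i = Fin.last k
    · rw [hi, hcl]; exact he₀
    · rw [(hcn i hi).1]; exact hF' (he i (hcn i hi).2).1
  · by_cases hi : i = Fin.last k
    · by_cases hj : j = Fin.last k
      · rw [hi, hj] at hij; exact X.bar_ne _ hij
      · rw [hi, hcl, (hcn j hj).1] at hij
        exact h₁ (hij ▸ (he j (hcn j hj).2).1)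
    · by_cases hj : j = Fin.last k
      · rw [hj, hcl] at hij
        have : c i = X.bar e₀ := by rw [← hij, X.bar_bar]
        rw [(hcn i hi).1] at this
        exact h₁ (this ▸ (he i (hcn i hi).2).1)
      -- Opposite edges `c i`, `c j` would give `i + 1 = j` and `j + 1 = i`, impossible since
      -- neither index is the last and so neither sum wraps around.
      · have h1 : X.s (c (i + 1)) = X.s (c j) := by rw [← ht, ← hij, X.s_bar]
        have h2 : X.s (c (j + 1)) = X.s (c i) := by rw [← ht, ← hij, X.t_bar]
        have h1 := hsinj h1
        have h2 := hsinj h2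
        have e1 := Fin.val_add_one_of_lt (Fin.lt_last_iff_ne_last.2 hi)
        have e2 := Fin.val_add_one_of_lt (Fin.lt_last_iff_ne_last.2 hj)
        rw [h1] at e1
        rw [h2] at e2
        omega

/-- The graph with vertices `V` and one pair of opposite edges for every arc in `A`. -/
def ofArcs {V A : Type} [Finite V] [Finite A] (src tgt : A → V) : SerreGraph where
  V := V
  E := A × Bool
  finite_V := inferInstance
  finite_E := inferInstance
  bar e := (e.1, !e.2)
  s e := if e.2 then src e.1 else tgt e.1
  t e := if e.2 then tgt e.1 else src e.1
  bar_bar e := by simp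
  bar_ne e := by
    obtain ⟨a, b⟩ := e
    cases b <;> simp
  s_bar e := by
    obtain ⟨a, b⟩ := e
    cases b <;> simp
  t_bar e := by
    obtain ⟨a, b⟩ := e
    cases b <;> simp

section Incidence

variable {V A : Type} (src tgt : A → V)

/-- The arcs of `S` have connected union: any two vertices are joined by a path of such arcs. -/
def ArcConnected (S : Set A) : Prop :=
  ∀ v w : V, Relation.ReflTransGen
    (fun a b => ∃ x ∈ S, (src x = a ∧ tgt x = b) ∨ (tgt x = a ∧ src x = b)) v w

variable [DecidableEq V] (R : Type*) [CommRing R] (r : V)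

/-- The columns of the incidence matrix, augmented by the unit vector at `r`. -/
def incidence : Option A → V → R
  | none => Pi.single r 1
  | some a => Pi.single (tgt a) 1 - Pi.single (src a) 1

variable {src tgt}

/-- Starting from the unit vector at `r`, each arc along a path moves the unit vector to the next
vertex. No division is needed, so this works over `ℤ` as well as over `ℚ`. -/
theorem span_incidence_eq_top [Finite V] {S : Set (Option A)} (hr : none ∈ S)
    (h : ArcConnected src tgt (some ⁻¹' S)) :
    Submodule.span R (incidence src tgt R r '' S) = ⊤ := by
  have hmem : ∀ v : V, (Pi.single v 1 : V → R) ∈ Submodule.span R (incidence src tgt R r '' S) := by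
    intro v
    induction h r v with
    | refl => exact Submodule.subset_span ⟨none, hr, rfl⟩
    | tail _ hbc ih =>
      obtain ⟨x, hx, hx'⟩ := hbc
      have hmem : (Pi.single (tgt x) 1 - Pi.single (src x) 1 : V → R) ∈
          Submodule.span R (incidence src tgt R r '' S) :=
        Submodule.subset_span ⟨some x, hx, rfl⟩
      rcases hx' with ⟨rfl, rfl⟩ | ⟨rfl, rfl⟩
      · simpa using Submodule.add_mem _ ih hmem
      · simpa using Submodule.sub_mem _ ih hmem
  rw [eq_top_iff, ← (Pi.basisFun R V).span_eq, Submodule.span_le]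
  rintro _ ⟨v, rfl⟩
  simpa using hmem v

/-- If `none` is missing, the constant function `1` kills every arc. Otherwise the indicator of the
complement of the component of `r` does, and it vanishes at `r`. -/
theorem exists_dotProduct_incidence_eq_zero [Fintype V] [Nontrivial R] {S : Set (Option A)}
    (h : ¬ (none ∈ S ∧ ArcConnected src tgt (some ⁻¹' S))) :
    ∃ φ : V → R, φ ≠ 0 ∧ ∀ o ∈ S, φ ⬝ᵥ incidence src tgt R r o = 0 := by
  classical
  by_cases hr : none ∈ S
  · let C : V → V → Prop := Relation.ReflTransGen
      (fun a b => ∃ x ∈ some ⁻¹' S, (src x = a ∧ tgt x = b) ∨ (tgt x = a ∧ src x = b))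
    have hsymm : ∀ v w, C v w → C w v := by
      have : Std.Symm (fun a b => ∃ x ∈ some ⁻¹' S,
          (src x = a ∧ tgt x = b) ∨ (tgt x = a ∧ src x = b)) :=
        ⟨fun a b ⟨x, hx, hx'⟩ => ⟨x, hx, hx'.symm.imp And.symm And.symm⟩⟩
      exact fun v w => Relation.ReflTransGen.stdSymm.symm v w
    have hC : ∃ v, ¬ C r v := by
      by_contra! hC
      exact h ⟨hr, fun v w => (hsymm r v (hC v)).trans (hC w)⟩
    obtain ⟨v, hv⟩ := hC
    refine ⟨fun w => if C r w then 0 else 1, fun h0 => ?_, fun o ho => ?_⟩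
    · have := congrFun h0 v
      simp [hv] at this
    · cases o with
      | none =>
        have : C r r := Relation.ReflTransGen.refl
        simp [incidence, this]
      | some x =>
        have : C r (src x) ↔ C r (tgt x) :=
          ⟨fun h => h.tail ⟨x, ho, Or.inl ⟨rfl, rfl⟩⟩, fun h => h.tail ⟨x, ho, Or.inr ⟨rfl, rfl⟩⟩⟩
        simp [incidence, dotProduct_sub, this]
  · refine ⟨fun _ => 1, fun h0 => one_ne_zero (congrFun h0 r), fun o ho => ?_⟩
    cases o with
    | none => exact absurd ho hr
    | some x => simp [incidence, dotProduct_sub]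

end Incidence

end SerreGraph

/-! ### The matrix-tree theorem. -/

namespace SerreGraph

variable {V A : Type} [Fintype A] [Fintype V] {src tgt : A → V}

theorem connectedOn_ofArcs_iff [Nonempty V] (S : Set A) :
    (ofArcs src tgt).ConnectedOn {e | e.1 ∈ S} ↔ ArcConnected src tgt S := by
  have hrel : (fun a b => ∃ e ∈ ({e | e.1 ∈ S} : Set (ofArcs src tgt).E),
      (ofArcs src tgt).s e = a ∧ (ofArcs src tgt).t e = b)
      = fun a b => ∃ x ∈ S, (src x = a ∧ tgt x = b) ∨ (tgt x = a ∧ src x = b) := by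
    ext a b
    constructor
    · rintro ⟨⟨x, _ | _⟩, hx, h1, h2⟩
      · exact ⟨x, hx, Or.inr ⟨h1, h2⟩⟩
      · exact ⟨x, hx, Or.inl ⟨h1, h2⟩⟩
    · rintro ⟨x, hx, ⟨h1, h2⟩ | ⟨h1, h2⟩⟩
      · exact ⟨(x, true), hx, h1, h2⟩
      · exact ⟨(x, false), hx, h1, h2⟩
  unfold ConnectedOn ArcConnected
  rw [hrel]
  exact ⟨fun h => h.2, fun h => ⟨‹Nonempty V›, h⟩⟩

/-- Along a cycle the arc vectors, signed by direction of travel, telescope to zero. The arcs are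
distinct because a cycle repeats no source and never uses both an edge and its opposite. -/
theorem acyclicOn_ofArcs_of_linearIndependent [DecidableEq V] {S : Set A}
    (h : LinearIndependent ℚ
      (fun a : S => (Pi.single (tgt a) 1 - Pi.single (src a) 1 : V → ℚ))) :
    (ofArcs src tgt).AcyclicOn {e | e.1 ∈ S} := by
  rintro ⟨k, c, hc, hst, hinj, hbar⟩
  have hcinj : Function.Injective fun i => (⟨(c i).1, hc i⟩ : S) := by
    intro i j hij
    have h1 : (c i).1 = (c j).1 := congrArg Subtype.val hij
    by_cases h2 : (c i).2 = (c j).2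
    · have : c i = c j := Prod.ext h1 h2
      exact hinj (congrArg (ofArcs src tgt).s this)
    · refine (hbar i j (Prod.ext h1 ?_)).elim
      change (!(c i).2) = (c j).2
      revert h2
      cases (c i).2 <;> cases (c j).2 <;> simp
  have hli := h.comp _ hcinj
  rw [Fintype.linearIndependent_iff] at hli
  let σ : A × Bool → V := (ofArcs src tgt).s
  let τ : A × Bool → V := (ofArcs src tgt).t
  have hστ : ∀ i, τ (c i) = σ (c (i + 1)) := hst
  have hterm : ∀ i, (if (c i).2 then 1 else -1 : ℚ) •
      (Pi.single (tgt (c i).1) 1 - Pi.single (src (c i).1) 1 : V → ℚ)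
      = Pi.single (τ (c i)) 1 - Pi.single (σ (c i)) 1 := by
    intro i
    simp only [σ, τ, ofArcs]
    cases (c i).2 <;> simp
  have := hli (fun i => if (c i).2 then 1 else -1) (by
    simp only [Function.comp_apply]
    rw [Finset.sum_congr rfl fun i _ => hterm i, Finset.sum_sub_distrib, sub_eq_zero]
    refine Fintype.sum_equiv (Equiv.addRight 1) _ _ fun i => ?_
    rw [hστ i]
    rfl) 0
  split_ifs at this <;> norm_num at this

/-- Connectedness means that the incidence vectors of `S`, together with the unit vector at `r`,
span `ℚ ^ V`; acyclicity corresponds to their independence. A spanning tree is thus a basis, and the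
count of a basis can replace acyclicity. -/
theorem isSpanningTree_ofArcs_iff [DecidableEq V] [Nonempty V] (S : Finset A) :
    (ofArcs src tgt).IsSpanningTree {e | e.1 ∈ S} ↔
      S.card + 1 = Fintype.card V ∧ ArcConnected src tgt (S : Set A) := by
  obtain ⟨r⟩ := ‹Nonempty V›
  have hV : Nonempty V := ⟨r⟩
  have hpre : (some ⁻¹' (Finset.insertNone S : Set (Option A))) = (S : Set A) := by
    ext; simp
  have hspan : ArcConnected src tgt (S : Set A) →
      ⊤ ≤ Submodule.span ℚ (Set.range fun o : Finset.insertNone S => incidence src tgt ℚ r o) := by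
    intro hconn
    have := span_incidence_eq_top (S := (Finset.insertNone S : Set (Option A))) ℚ r
      (by simp) (by rwa [hpre])
    rw [← this]
    apply Submodule.span_mono
    rintro _ ⟨o, ho, rfl⟩
    exact ⟨⟨o, ho⟩, rfl⟩
  constructor
  · intro h
    have hconn := (connectedOn_ofArcs_iff (S : Set A)).1 h.connected
    refine ⟨?_, hconn⟩
    have hli : LinearIndependent ℚ
        (fun o : Finset.insertNone S => incidence src tgt ℚ r o) := by
      -- A dependent vector `o` is redundant: the others still span, so they contain `none` and
      -- their arcs still connect all vertices. Hence `o` is an arc whose ends are joined without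
      -- it, and it lies on a cycle.
      by_contra hli
      rw [linearIndependent_iff_notMem_span] at hli
      push Not at hli
      obtain ⟨⟨o, ho⟩, hmem⟩ := hli
      have himg : ((fun o : Finset.insertNone S => incidence src tgt ℚ r o) ''
          (Set.univ \ {⟨o, ho⟩})) = incidence src tgt ℚ r '' (Finset.insertNone S \ {o}) := by
        ext x
        constructor
        · rintro ⟨⟨o', ho'⟩, hne, rfl⟩
          exact ⟨o', ⟨ho', fun h => hne.2 (Subtype.ext h)⟩, rfl⟩
        · rintro ⟨o', ⟨ho', hne⟩, rfl⟩
          exact ⟨⟨o', ho'⟩, ⟨trivial, fun h => hne (congrArg Subtype.val h)⟩, rfl⟩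
      rw [himg] at hmem
      have hrem : none ∈ ((Finset.insertNone S : Set (Option A)) \ {o}) ∧
          ArcConnected src tgt (some ⁻¹' ((Finset.insertNone S : Set (Option A)) \ {o})) := by
        by_contra hno
        obtain ⟨φ, hφ, h0⟩ := exists_dotProduct_incidence_eq_zero ℚ r hno
        have hker : ∀ x ∈ Submodule.span ℚ (incidence src tgt ℚ r '' (Finset.insertNone S \ {o})),
            φ ⬝ᵥ x = 0 := by
          intro x hx
          induction hx using Submodule.span_induction with
          | mem x hx =>
            obtain ⟨o', ho', rfl⟩ := hx
            exact h0 o' ho'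
          | zero => simp
          | add x y _ _ hx hy => rw [dotProduct_add, hx, hy, add_zero]
          | smul c x _ hx => rw [dotProduct_smul, hx, smul_zero]
        have hker' : ∀ x : V → ℚ, φ ⬝ᵥ x = 0 := by
          intro x
          have hx := hspan hconn (Submodule.mem_top (x := x))
          induction hx using Submodule.span_induction with
          | mem x hx =>
            obtain ⟨⟨o', ho'⟩, rfl⟩ := hx
            by_cases h : o' = o
            · subst h; exact hker _ hmem
            · exact h0 o' ⟨ho', h⟩
          | zero => simp
          | add x y _ _ hx hy => rw [dotProduct_add, hx, hy, add_zero]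
          | smul c x _ hx => rw [dotProduct_smul, hx, smul_zero]
        -- Being orthogonal to everything, `φ` is orthogonal to itself, which over `ℚ` forces `φ =
        -- 0`.
        exact hφ (dotProduct_self_eq_zero.1 (hker' φ))
      obtain ⟨hnone, hrem⟩ := hrem
      cases o with
      | none => exact hnone.2 rfl
      | some a =>
        have haS : a ∈ S := by simpa using ho
        have hS : some ⁻¹' ((Finset.insertNone S : Set (Option A)) \ {some a}) = (S : Set A) \ {a} := by
          ext; simp
        rw [hS] at hrem
        have hpath := ((connectedOn_ofArcs_iff ((S : Set A) \ {a})).2 hrem).2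
          ((ofArcs src tgt).t (a, true)) ((ofArcs src tgt).s (a, true))
        refine not_acyclicOn_of_path (X := ofArcs src tgt) (F := {e | e.1 ∈ S}) (e₀ := (a, true)) ?_ haS ?_ hpath h.acyclic
        · exact fun (e : A × Bool) (he : e.1 ∈ (S : Set A) \ {a}) => he.1
        · exact fun h => h.2 rfl
    have := Module.finrank_eq_card_basis (Module.Basis.mk hli (hspan hconn))
    rw [Module.finrank_fintype_fun_eq_card] at this
    rw [this, Fintype.card_coe, Finset.card_insertNone]
  · rintro ⟨hcard, hconn⟩
    refine ⟨fun e he => he, (connectedOn_ofArcs_iff (S : Set A)).2 hconn, ?_⟩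
    have hli := linearIndependent_of_top_le_span_of_card_eq_finrank (hspan hconn) (by
      rw [Module.finrank_fintype_fun_eq_card, Fintype.card_coe, Finset.card_insertNone, hcard])
    exact acyclicOn_ofArcs_of_linearIndependent (S := (S : Set A))
      (hli.comp (fun a : (S : Set A) => ⟨some a.1, Finset.some_mem_insertNone.2 a.2⟩) fun a b hab =>
        Subtype.ext (Option.some.inj (congrArg Subtype.val hab)))

theorem numSpanningTrees_ofArcs_eq_card [DecidableEq V] [Nonempty V] :
    (ofArcs src tgt).numSpanningTrees = Nat.card {S : Finset A //
      S.card + 1 = Fintype.card V ∧ ArcConnected src tgt (S : Set A)} := by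
  classical
  refine (Nat.card_congr (Equiv.ofBijective (fun S => ⟨{e | e.1 ∈ S.1},
    (isSpanningTree_ofArcs_iff S.1).2 S.2⟩) ⟨?_, ?_⟩)).symm
  · rintro ⟨S, hS⟩ ⟨S', hS'⟩ h
    have h := congrArg Subtype.val h
    apply Subtype.ext
    ext a
    exact Set.ext_iff.1 h (a, true)
  · rintro ⟨F, hF⟩
    have hFS : {e : (ofArcs src tgt).E | e.1 ∈ Finset.univ.filter fun a => (a, true) ∈ F} = F := by
      ext ⟨a, b⟩
      simp only [Finset.mem_filter, Finset.mem_univ, true_and]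
      cases b
      · exact ⟨fun h => hF.bar_mem _ h, fun h => hF.bar_mem _ h⟩
      · exact Iff.rfl
    refine ⟨⟨_, (isSpanningTree_ofArcs_iff _).1 ((congrArg _ hFS).mpr hF)⟩, Subtype.ext hFS⟩

/-- The matrix-tree theorem, for the matrix `L + E_rr`. -/
theorem numSpanningTrees_ofArcs_eq_det [DecidableEq V] (r : V) :
    ((ofArcs src tgt).numSpanningTrees : ℤ)
      = (Matrix.of (fun v o => incidence src tgt ℤ r o v) *
          (Matrix.of fun v o => incidence src tgt ℤ r o v).transpose).det := by
  classical
  have : Nonempty V := ⟨r⟩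
  rw [Matrix.det_mul_transpose_eq_sum _ fun S : Finset (Option A) =>
    if none ∈ S ∧ ArcConnected src tgt (some ⁻¹' (S : Set (Option A))) then 1 else 0]
  · rw [numSpanningTrees_ofArcs_eq_card, Finset.sum_boole, Nat.card_eq_fintype_card,
      Fintype.card_subtype]
    congr 1
    refine Finset.card_bij (fun S _ => Finset.insertNone S) ?_ ?_ ?_
    · intro S hS
      simp only [Finset.mem_filter, Finset.mem_univ, true_and] at hS
      have hpre : (some ⁻¹' (Finset.insertNone S : Set (Option A))) = (S : Set A) := by
        ext; simp
      simp only [Finset.mem_filter, Finset.mem_powersetCard, hpre]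
      exact ⟨⟨Finset.subset_univ _, by rw [Finset.card_insertNone, hS.1]⟩, by simp, hS.2⟩
    · intro S _ S' _ h
      exact Finset.insertNone.injective h
    · intro T hT
      simp only [Finset.mem_filter, Finset.mem_powersetCard] at hT
      obtain ⟨⟨-, hcard⟩, hnone, hconn⟩ := hT
      have hT : Finset.insertNone (Finset.eraseNone T) = T := by
        rw [Finset.insertNone_eraseNone, Finset.insert_eq_of_mem hnone]
      refine ⟨Finset.eraseNone T, ?_, hT⟩
      have hpre : (some ⁻¹' (T : Set (Option A))) = (Finset.eraseNone T : Set A) := by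
        ext; simp
      simp only [Finset.mem_filter, Finset.mem_univ, true_and]
      exact ⟨by rw [← Finset.card_insertNone, hT, hcard], hpre ▸ hconn⟩
  · intro f hf
    have hrange : incidence src tgt ℤ r '' (Finset.univ.image f : Finset (Option A))
        = Set.range fun j => incidence src tgt ℤ r (f j) := by
      ext; simp
    split_ifs with h
    · have hspan := span_incidence_eq_top ℤ r (S := ((Finset.univ.image f : Finset (Option A)) : Set (Option A)))
        (by exact_mod_cast h.1) h.2
      rw [hrange] at hspan
      have hsurj : Function.Surjective
          ((Matrix.of fun v o => incidence src tgt ℤ r o v).submatrix id f).mulVec := by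
        have := Matrix.range_mulVecLin
          ((Matrix.of fun v o => incidence src tgt ℤ r o v).submatrix id f)
        exact LinearMap.range_eq_top.1 (this.trans hspan)
      -- Spanning over `ℤ`, not merely over `ℚ`, makes the minor `±1`, so each tree contributes
      -- exactly `1`.
      have hunit := (Matrix.isUnit_iff_isUnit_det _).1 (Matrix.mulVec_surjective_iff_isUnit.1 hsurj)
      rcases Int.isUnit_iff.1 hunit with h | h <;> rw [h] <;> norm_num
    · obtain ⟨φ, hφ, h0⟩ := exists_dotProduct_incidence_eq_zero ℤ r
        (S := ((Finset.univ.image f : Finset (Option A)) : Set (Option A))) (by exact_mod_cast h)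
      rw [(Matrix.exists_vecMul_eq_zero_iff).1 ⟨φ, hφ, ?_⟩, zero_pow two_ne_zero]
      ext j
      exact h0 (f j) (by simp)

/-- The Laplacian. -/
def laplacian [DecidableEq V] (src tgt : A → V) (R : Type*) [CommRing R] : Matrix V V R :=
  ∑ a, Matrix.vecMulVec (Pi.single (tgt a) 1 - Pi.single (src a) 1)
    (Pi.single (tgt a) 1 - Pi.single (src a) 1)

/-- The matrix-tree theorem, in terms of the Laplacian and the all-ones matrix. -/
theorem card_sq_mul_numSpanningTrees_ofArcs [DecidableEq V] [Nonempty V] (R : Type*) [CommRing R] :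
    (Fintype.card V : R) ^ 2 * (ofArcs src tgt).numSpanningTrees
      = (laplacian src tgt R + Matrix.of fun _ _ => 1).det := by
  obtain ⟨r⟩ := ‹Nonempty V›
  have hmat : Matrix.of (fun v o => incidence src tgt ℤ r o v) *
      (Matrix.of fun v o => incidence src tgt ℤ r o v).transpose
      = laplacian src tgt ℤ + Matrix.single r r 1 := by
    ext v w
    simp only [Matrix.mul_apply, Matrix.transpose_apply, Matrix.of_apply, Fintype.sum_option,
      incidence, laplacian, Matrix.add_apply, Matrix.sum_apply, Matrix.vecMulVec_apply]
    rw [add_comm]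
    congr 1
    simp only [Matrix.single_apply, Pi.single_apply]
    by_cases h : r = v <;> by_cases h' : r = w <;> simp [h, h', eq_comm]
  have key := Matrix.card_sq_mul_det_add_single (laplacian src tgt ℤ) r
    (fun i => by
      simp only [laplacian, Matrix.sum_apply, Matrix.vecMulVec_apply]
      rw [Finset.sum_comm]
      simp [← Finset.mul_sum])
    (fun i => by
      simp only [laplacian, Matrix.sum_apply, Matrix.vecMulVec_apply]
      rw [Finset.sum_comm]
      simp [← Finset.sum_mul])
  rw [← hmat, ← numSpanningTrees_ofArcs_eq_det] at key
  have := congrArg (Int.castRingHom R) key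
  rw [RingHom.map_det] at this
  simp only [map_mul, map_pow, eq_intCast, Int.cast_natCast] at this
  rw [this]
  congr 1
  ext v w
  have hsingle : ∀ x y : V, Int.castRingHom R ((Pi.single x 1 : V → ℤ) y)
      = (Pi.single x 1 : V → R) y := by
    intro x y
    rw [Pi.single_apply, Pi.single_apply]
    split_ifs <;> simp
  simp only [RingHom.mapMatrix_apply, Matrix.map_apply, Matrix.add_apply, laplacian,
    Matrix.sum_apply, Matrix.vecMulVec_apply, map_add, map_sum, map_mul, Pi.sub_apply, map_sub,
    Matrix.of_apply, map_one, hsingle]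

end SerreGraph

/-! ### Spanning trees of Cayley graphs of cyclic groups, by characters. -/

namespace SerreGraph

open Matrix

/-- The Cayley graph of `ℤ/N` with one pair of opposite edges `v ⇄ v + α i` for every vertex `v`
and every `i`. -/
def cayley (N : ℕ) [NeZero N] {ι : Type} [Finite ι] (α : ι → ℕ) : SerreGraph :=
  ofArcs (V := ZMod N) (A := ZMod N × ι) (fun a => a.1) (fun a => a.1 + (α a.2 : ZMod N))

/-- The eigenvalue `∑ i, (2 - z ^ α i - z ^ (-α i))` of the Laplacian of a Cayley graph of a cyclic
group at a root of unity `z`. -/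
noncomputable def laplaceSymbol {ι : Type} [Fintype ι] (α : ι → ℕ) {K : Type*} [CommRing K]
    (z : K) : K :=
  ∑ i, (2 - z ^ α i - Ring.inverse z ^ α i)

variable {N : ℕ} [NeZero N] {ι : Type} [Fintype ι] (α : ι → ℕ) {K : Type*} [CommRing K]

/-- The Laplacian is a combination of translations, and translation by `α i` multiplies a character
by its value `ψ 1 ^ α i`. -/
theorem laplacian_mulVec_addChar (ψ : AddChar (ZMod N) K) :
    laplacian (V := ZMod N) (A := ZMod N × ι) (fun a => a.1) (fun a => a.1 + (α a.2 : ZMod N)) K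
      *ᵥ ψ = laplaceSymbol α (ψ 1) • ⇑ψ := by
  have hpow : ∀ a : ℕ, ψ (a : ZMod N) = ψ 1 ^ a := by
    intro a
    rw [← AddChar.map_nsmul_eq_pow, nsmul_one]
  have hinv : ∀ x : ZMod N, ψ (-x) = Ring.inverse (ψ x) := by
    intro x
    have h : ψ x * ψ (-x) = 1 := by rw [← AddChar.map_add_eq_mul, add_neg_cancel, AddChar.map_zero_eq_one]
    calc ψ (-x) = Ring.inverse (ψ x) * (ψ x * ψ (-x)) := by
          rw [← mul_assoc, Ring.inverse_mul_cancel _ (IsUnit.of_mul_eq_one _ h), one_mul]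
      _ = _ := by rw [h, mul_one]
  ext v
  simp only [laplacian, sum_mulVec, vecMulVec_mulVec, sub_dotProduct, single_one_dotProduct,
    Finset.sum_apply, Pi.smul_apply, smul_eq_mul, Fintype.sum_prod_type_right, Pi.sub_apply,
    MulOpposite.smul_eq_mul_unop, MulOpposite.unop_op]
  rw [laplaceSymbol, Finset.sum_mul]
  refine Finset.sum_congr rfl fun i _ => ?_
  simp only [sub_mul, Finset.sum_sub_distrib]
  have h1 : ∑ u : ZMod N, (Pi.single (u + (α i : ZMod N)) (1 : K) : ZMod N → K) v
      * (ψ (u + α i) - ψ u) = ψ v - ψ (v - α i) := by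
    rw [Finset.sum_eq_single (v - (α i : ZMod N))]
    · simp
    · intro b _ hb
      rw [Pi.single_eq_of_ne, zero_mul]
      rintro rfl
      simp at hb
    · simp
  have h2 : ∑ u : ZMod N, (Pi.single u (1 : K) : ZMod N → K) v
      * (ψ (u + α i) - ψ u) = ψ (v + α i) - ψ v := by
    rw [Finset.sum_eq_single v]
    · simp
    · intro b _ hb
      rw [Pi.single_eq_of_ne hb.symm, zero_mul]
    · simp
  rw [h1, h2, sub_eq_add_neg v, AddChar.map_add_eq_mul, AddChar.map_add_eq_mul, hinv, hpow,
    Ring.inverse_pow]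
  ring

/-- The characters diagonalise both the Laplacian and the all-ones matrix. The latter acts as `N` on
the trivial character and as `0` on the others, so the trivial character contributes `N`, which
cancels one factor of `N ^ 2`. -/
theorem card_mul_numSpanningTrees_cayley [IsDomain K] [CharZero K] [DecidableEq K] {ζ : K}
    (hζ : IsPrimitiveRoot ζ N) :
    (N : K) * (cayley N α).numSpanningTrees
      = ∏ z ∈ (Polynomial.nthRootsFinset N (1 : K)).erase 1, laplaceSymbol α z := by
  have hN : 0 < N := Nat.pos_of_ne_zero (NeZero.ne N)
  have hz : ∀ j : ZMod N, (ζ ^ j.val) ^ N = 1 := by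
    intro j
    rw [← pow_mul, mul_comm, pow_mul, hζ.pow_eq_one, one_pow]
  let ψ : ZMod N → AddChar (ZMod N) K := fun j => AddChar.zmodChar N (hz j)
  have hψ1 : ∀ j, ψ j 1 = ζ ^ j.val := by
    intro j
    simpa using AddChar.zmodChar_apply' (hz j) 1
  have hinj : Function.Injective fun j : ZMod N => ζ ^ j.val := by
    intro j k h
    exact ZMod.val_injective N (hζ.pow_inj (ZMod.val_lt j) (ZMod.val_lt k) h)
  let M : Matrix (ZMod N) (ZMod N) K := of fun v j => ψ j v
  let D : ZMod N → K := fun j => laplaceSymbol α (ζ ^ j.val) + if j = 0 then (N : K) else 0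
  -- Linear independence of distinct characters; an inverse matrix would require dividing by `N`,
  -- which the ring `K` need not allow.
  have hM : M.det ≠ 0 := by
    intro h0
    obtain ⟨x, hx, hMx⟩ := exists_mulVec_eq_zero_iff.2 h0
    have hli := (linearIndependent_monoidHom (Multiplicative (ZMod N)) K).comp
      (fun j => (ψ j).toMonoidHom) (by
        intro j k h
        apply hinj
        have := DFunLike.congr_fun h (Multiplicative.ofAdd 1)
        change ψ j 1 = ψ k 1 at this
        rwa [hψ1, hψ1] at this)
    rw [Fintype.linearIndependent_iff] at hli
    refine hx (funext fun j => hli x ?_ j)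
    ext v
    have := congrFun hMx v.toAdd
    simp only [mulVec, dotProduct, M, of_apply, Pi.zero_apply] at this
    rw [Pi.zero_apply, ← this, Finset.sum_apply]
    exact Finset.sum_congr rfl fun j _ => mul_comm _ _
  have hdiag : (laplacian (V := ZMod N) (A := ZMod N × ι) (fun a => a.1)
      (fun a => a.1 + (α a.2 : ZMod N)) K + of fun _ _ => 1) * M = M * diagonal D := by
    ext v j
    have h1 := congrFun (laplacian_mulVec_addChar α (ψ j)) v
    have h2 : ∑ w, ψ j w = if j = 0 then (N : K) else 0 := by
      classical
      rw [AddChar.sum_eq_ite, ZMod.card]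
      refine if_congr ⟨fun h => ?_, fun h => ?_⟩ rfl rfl
      · apply hinj
        have := DFunLike.congr_fun h 1
        rw [hψ1, AddChar.zero_apply] at this
        simpa using this
      · subst h
        ext w
        simp [ψ, AddChar.zmodChar_apply]
    rw [mul_diagonal, Matrix.add_mul, Matrix.add_apply]
    have h3 : ((of fun _ _ : ZMod N => (1 : K)) * M) v j = ∑ w, ψ j w := by
      simp [Matrix.mul_apply, M]
    rw [h3, h2]
    have h4 : (laplacian (V := ZMod N) (A := ZMod N × ι) (fun a => a.1)
      (fun a => a.1 + (α a.2 : ZMod N)) K * M) v j = laplaceSymbol α (ψ j 1) * ψ j v := h1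
    rw [h4, hψ1]
    simp only [M, of_apply, D, mul_comm]
    split_ifs with h
    · subst h; simp [ψ, AddChar.zmodChar_apply]
    · simp
  have hdet := congrArg det hdiag
  rw [det_mul, det_mul, det_diagonal, mul_comm M.det] at hdet
  have hdet := mul_right_cancel₀ hM hdet
  have htree := card_sq_mul_numSpanningTrees_ofArcs (V := ZMod N) (A := ZMod N × ι)
    (src := fun a => a.1) (tgt := fun a => a.1 + (α a.2 : ZMod N)) K
  rw [hdet, ZMod.card, ← Finset.mul_prod_erase _ _ (Finset.mem_univ 0)] at htree
  have hone : laplaceSymbol α (1 : K) = 0 := by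
    refine Finset.sum_eq_zero fun i _ => ?_
    rw [Ring.inverse_one, one_pow]
    norm_num
  have hD0 : D 0 = N := by simp [D, hone]
  have hprod : ∏ j ∈ Finset.univ.erase 0, D j
      = ∏ z ∈ (Polynomial.nthRootsFinset N (1 : K)).erase 1, laplaceSymbol α z := by
    refine Finset.prod_bij (fun j _ => ζ ^ j.val) ?_ ?_ ?_ ?_
    · intro j hj
      refine Finset.mem_erase.2 ⟨fun h => (Finset.mem_erase.1 hj).1 (hinj ?_),
        (Polynomial.mem_nthRootsFinset hN 1).2 (hz j)⟩
      simpa using h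
    · intro j _ k _ h
      exact hinj h
    · intro z hz
      obtain ⟨hz1, hz⟩ := Finset.mem_erase.1 hz
      obtain ⟨i, hi, rfl⟩ := hζ.eq_pow_of_pow_eq_one ((Polynomial.mem_nthRootsFinset hN 1).1 hz)
      refine ⟨(i : ZMod N), Finset.mem_erase.2 ⟨fun h => hz1 ?_, Finset.mem_univ _⟩, ?_⟩
      · rw [ZMod.natCast_eq_zero_iff] at h
        rw [Nat.eq_zero_of_dvd_of_lt h hi, pow_zero]
      · rw [ZMod.val_natCast, Nat.mod_eq_of_lt hi]
    · intro j hj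
      simp [D, (Finset.mem_erase.1 hj).1]
  rw [hD0, hprod, pow_two, mul_assoc] at htree
  exact mul_left_cancel₀ (Nat.cast_ne_zero.2 hN.ne') htree

/-- A `pⁿ⁺¹`-th root of unity is either a `pⁿ`-th root of unity or primitive, so one product formula
divides the other. -/
theorem prime_mul_numSpanningTrees_cayley [IsDomain K] [CharZero K] {p : ℕ} [Fact p.Prime]
    {n : ℕ} {ζ : K} (hζ : IsPrimitiveRoot ζ (p ^ (n + 1))) :
    (p : K) * (cayley (p ^ (n + 1)) α).numSpanningTrees
      = (cayley (p ^ n) α).numSpanningTrees *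
        ∏ z ∈ primitiveRoots (p ^ (n + 1)) K, laplaceSymbol α z := by
  classical
  have hp : p.Prime := Fact.out
  have hpos : ∀ k, 0 < p ^ k := fun k => pow_pos hp.pos k
  have hζ' : IsPrimitiveRoot (ζ ^ p) (p ^ n) := hζ.pow (hpos _) (pow_succ' p n)
  have h1 := card_mul_numSpanningTrees_cayley α hζ
  have h0 := card_mul_numSpanningTrees_cayley α hζ'
  have hunion : (Polynomial.nthRootsFinset (p ^ (n + 1)) (1 : K)).erase 1
      = (Polynomial.nthRootsFinset (p ^ n) (1 : K)).erase 1 ∪ primitiveRoots (p ^ (n + 1)) K := by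
    ext z
    simp only [Finset.mem_union, Finset.mem_erase, Polynomial.mem_nthRootsFinset (hpos _),
      mem_primitiveRoots (hpos _)]
    constructor
    · rintro ⟨hz1, hz⟩
      by_cases h : z ^ p ^ n = 1
      · exact Or.inl ⟨hz1, h⟩
      · exact Or.inr (IsPrimitiveRoot.iff_orderOf.2 (orderOf_eq_prime_pow h hz))
    · rintro (⟨hz1, hz⟩ | hz)
      · exact ⟨hz1, by rw [pow_succ, pow_mul, hz, one_pow]⟩
      · exact ⟨hz.ne_one (Nat.one_lt_pow n.succ_ne_zero hp.one_lt), hz.pow_eq_one⟩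
  have hdisj : Disjoint ((Polynomial.nthRootsFinset (p ^ n) (1 : K)).erase 1)
      (primitiveRoots (p ^ (n + 1)) K) := by
    refine Finset.disjoint_left.2 fun z hz hz' => ?_
    have hz := (Polynomial.mem_nthRootsFinset (hpos _) 1).1 (Finset.mem_erase.1 hz).2
    exact ((mem_primitiveRoots (hpos _)).1 hz').pow_ne_one_of_pos_of_lt (hpos n).ne'
      (Nat.pow_lt_pow_right hp.one_lt n.lt_succ_self) hz
  rw [hunion, Finset.prod_union hdisj, ← h0] at h1
  refine mul_left_cancel₀ (Nat.cast_ne_zero.2 (hpos n).ne' : ((p ^ n : ℕ) : K) ≠ 0) ?_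
  rw [← mul_assoc, ← mul_assoc, ← Nat.cast_mul, ← pow_succ, h1]

end SerreGraph

/-! ### The choice of voltages. -/

namespace SerreGraph

/-- Modulo `p`, every power of `2 - x - x⁻¹` is a sum of terms `2 - x ^ a - x ^ (-a)`. -/
theorem exists_list_sum_eq_pow {p : ℕ} (hp : 0 < p) {m : ℕ} (hm : 1 ≤ m) :
    ∃ l : List ℕ, ∀ (K : Type) [CommRing K] (x y : K), x * y = 1 →
      ∃ z, (l.map fun a => 2 - x ^ a - y ^ a).sum = (2 - x - y) ^ m + p * z := by
  induction m, hm using Nat.le_induction with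
  | base => exact ⟨[1], fun K _ x y _ => ⟨0, by simp⟩⟩
  | succ m _ ih =>
    obtain ⟨l, hl⟩ := ih
    -- With `T a = 2 - x ^ a - y ^ a` and `x * y = 1`, one has `T 1 * T (a + 1) = 2 * T 1 + 2 * T (a
    -- + 1) - T (a + 2) - T a`. The two coefficients `-1` become `p - 1`, at the cost of a multiple
    -- of `p`. For `a = 0` nothing is needed as `T 0 = 0`.
    let f : ℕ → List ℕ := fun
      | 0 => []
      | a + 1 => [1, 1, a + 1, a + 1] ++ (List.replicate (p - 1) (a + 2)
          ++ List.replicate (p - 1) a)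
    refine ⟨l.flatMap f, fun K _ x y hxy => ?_⟩
    have hf : ∀ a, ∃ z, ((f a).map fun a => 2 - x ^ a - y ^ a).sum
        = (2 - x - y) * (2 - x ^ a - y ^ a) + p * z := by
      intro a
      cases a with
      | zero => exact ⟨0, by simp [f]; ring⟩
      | succ a =>
        refine ⟨(2 - x ^ (a + 2) - y ^ (a + 2)) + (2 - x ^ a - y ^ a), ?_⟩
        simp only [f, List.map_append, List.map_cons, List.map_nil, List.sum_append, List.sum_cons,
          List.sum_nil, List.map_replicate, List.sum_replicate, nsmul_eq_mul, Nat.cast_sub hp,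
          Nat.cast_one]
        linear_combination (-(x ^ a + y ^ a)) * hxy
    have hfl : ∀ l : List ℕ, ∃ z, ((l.flatMap f).map fun a => 2 - x ^ a - y ^ a).sum
        = (2 - x - y) * (l.map fun a => 2 - x ^ a - y ^ a).sum + p * z := by
      intro l
      induction l with
      | nil => exact ⟨0, by simp⟩
      | cons a l ih =>
        obtain ⟨z, hz⟩ := ih
        obtain ⟨z', hz'⟩ := hf a
        refine ⟨z + z', ?_⟩
        rw [List.flatMap_cons, List.map_append, List.sum_append, hz, hz', List.map_cons,
          List.sum_cons]
        ring
    obtain ⟨z, hz⟩ := hl K x y hxy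
    obtain ⟨z', hz'⟩ := hfl l
    exact ⟨(2 - x - y) * z + z', by rw [hz', hz]; ring⟩

/-- There are voltages, one of them equal to `1`, whose Laplacian eigenvalues are
`p ^ μ * ((2 - z - z⁻¹) ^ m + p * y)`. -/
theorem exists_laplaceSymbol_eq {p : ℕ} (hp : 0 < p) {m : ℕ} (hm : 1 ≤ m) (μ : ℕ) :
    ∃ (ι : Type) (_ : Fintype ι) (α : ι → ℕ), (∃ i, α i = 1) ∧
      ∀ (K : Type) [CommRing K] (z : K), IsUnit z →
        ∃ y, laplaceSymbol α z = p ^ μ * ((2 - z - Ring.inverse z) ^ m + p * y) := by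
  obtain ⟨l, hl⟩ := exists_list_sum_eq_pow hp hm
  -- The extra `p` copies of `1` change the sum by a multiple of `p` only and ensure that the
  -- voltage `1` occurs. Taking the whole list `p ^ μ` times then gives the factor `p ^ μ`.
  let l' := l ++ List.replicate p 1
  refine ⟨Fin (p ^ μ) × Fin l'.length, inferInstance, fun i => l'.get i.2, ?_, fun K _ z hz => ?_⟩
  · have : 1 ∈ l' := List.mem_append_right _ (List.mem_replicate.2 ⟨hp.ne', rfl⟩)
    obtain ⟨i, hi⟩ := List.mem_iff_get.1 this
    exact ⟨(⟨0, pow_pos hp μ⟩, i), hi⟩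
  · obtain ⟨y, hy⟩ := hl K z (Ring.inverse z) (Ring.mul_inverse_cancel z hz)
    refine ⟨y + (2 - z - Ring.inverse z), ?_⟩
    have hsum : ∑ i : Fin l'.length, (2 - z ^ l'.get i - Ring.inverse z ^ l'.get i)
        = (l'.map fun a => 2 - z ^ a - Ring.inverse z ^ a).sum :=
      Fin.sum_univ_fun_getElem l' fun a => 2 - z ^ a - Ring.inverse z ^ a
    simp only [laplaceSymbol, Fintype.sum_prod_type]
    rw [Finset.sum_const, hsum, Finset.card_univ, Fintype.card_fin, nsmul_eq_mul, List.map_append,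
      List.sum_append, hy]
    simp
    ring

/-! ### Orders at a prime above `p`. -/

section Valuation

variable {K : Type} [CommRing K] [IsDomain K] {p : ℕ} [Fact p.Prime] {k : ℕ}

theorem prod_one_sub_primitiveRoots {ζ : K} (hζ : IsPrimitiveRoot ζ (p ^ (k + 1))) :
    ∏ z ∈ primitiveRoots (p ^ (k + 1)) K, (1 - z) = p := by
  have := Polynomial.eval_one_cyclotomic_prime_pow (R := K) (p := p) k
  rw [Polynomial.cyclotomic_eq_prod_X_sub_primitiveRoots hζ, Polynomial.eval_prod] at this
  simpa using this

theorem one_sub_dvd_one_sub {z z' : K} (hz : IsPrimitiveRoot z (p ^ (k + 1)))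
    (hz' : IsPrimitiveRoot z' (p ^ (k + 1))) : 1 - z ∣ 1 - z' := by
  have : NeZero (p ^ (k + 1)) := ⟨(pow_pos (Fact.out : p.Prime).pos _).ne'⟩
  obtain ⟨i, -, rfl⟩ := hz.eq_pow_of_pow_eq_one hz'.pow_eq_one
  simpa using sub_dvd_pow_sub_pow 1 z i

/-- `p` is a product of `φ(p ^ (k + 1))` factors `1 - z'`, each divisible by `1 - z`. -/
theorem one_sub_pow_totient_dvd {z : K} (hz : IsPrimitiveRoot z (p ^ (k + 1))) :
    (1 - z) ^ (p ^ (k + 1)).totient ∣ (p : K) := by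
  have hpos : 0 < p ^ (k + 1) := pow_pos (Fact.out : p.Prime).pos _
  rw [← prod_one_sub_primitiveRoots hz, ← hz.card_primitiveRoots, ← Finset.prod_const]
  exact Finset.prod_dvd_prod_of_dvd _ _ fun z' hz' =>
    one_sub_dvd_one_sub hz ((mem_primitiveRoots hpos).1 hz')

theorem one_sub_mem_of_prime {P : Ideal K} [P.IsPrime] (hP : (p : K) ∈ P) {z : K}
    (hz : IsPrimitiveRoot z (p ^ (k + 1))) : 1 - z ∈ P := by
  have hpos : 0 < p ^ (k + 1) := pow_pos (Fact.out : p.Prime).pos _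
  rw [← prod_one_sub_primitiveRoots hz, Ideal.IsPrime.prod_mem_iff] at hP
  obtain ⟨z', hz', h⟩ := hP
  exact P.mem_of_dvd (one_sub_dvd_one_sub ((mem_primitiveRoots hpos).1 hz') hz) h

/-- The bound `hk` makes `p` divisible by `(1 - z) ^ (2 * m + 1)`, so the error term `p * y` is of
higher order than `(2 - z - z⁻¹) ^ m`. Each factor is then `p ^ μ * (1 - z) ^ (2 * m)` up to an
element outside `P`. -/
theorem prod_laplaceSymbol_eq {P : Ideal K} [P.IsPrime] (hP : (p : K) ∈ P)
    {ι : Type} [Fintype ι] {α : ι → ℕ} {m μ : ℕ}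
    (hα : ∀ z : K, IsUnit z →
      ∃ y, laplaceSymbol α z = p ^ μ * ((2 - z - Ring.inverse z) ^ m + p * y))
    {ζ : K} (hζ : IsPrimitiveRoot ζ (p ^ (k + 1))) (hk : 2 * m < (p ^ (k + 1)).totient) :
    ∃ w ∉ P, ∏ z ∈ primitiveRoots (p ^ (k + 1)) K, laplaceSymbol α z
      = p ^ (μ * (p ^ (k + 1)).totient + 2 * m) * w := by
  have hpos : 0 < p ^ (k + 1) := pow_pos (Fact.out : p.Prime).pos _
  have hterm : ∀ z : K, ∃ w, IsPrimitiveRoot z (p ^ (k + 1)) →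
      w ∉ P ∧ laplaceSymbol α z = p ^ μ * (1 - z) ^ (2 * m) * w := by
    intro z
    by_cases hz : IsPrimitiveRoot z (p ^ (k + 1))
    swap
    · exact ⟨0, fun h => absurd h hz⟩
    have hunit : IsUnit z := hz.isUnit hpos.ne'
    have hinv := Ring.mul_inverse_cancel z hunit
    obtain ⟨y, hy⟩ := hα z hunit
    obtain ⟨t, ht⟩ := (pow_dvd_pow (1 - z) hk).trans (one_sub_pow_totient_dvd hz)
    rw [Nat.succ_eq_add_one, pow_succ] at ht
    refine ⟨(-Ring.inverse z) ^ m + (1 - z) * (t * y), fun _ => ⟨fun hmem => ?_, ?_⟩⟩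
    -- Modulo `P` the cofactor is a power of the unit `-z⁻¹`, because `1 - z` lies in `P`.
    · have h1 := (P.add_mem_iff_left
        (P.mul_mem_right (t * y) (one_sub_mem_of_prime hP hz))).1 hmem
      have h2 := P.mul_mem_left z (Ideal.IsPrime.mem_of_pow_mem ‹_› _ h1)
      rw [mul_neg, hinv] at h2
      exact Ideal.IsPrime.ne_top ‹_› ((Ideal.eq_top_iff_one _).2 (by simpa using P.neg_mem h2))
    · have h2 : 2 - z - Ring.inverse z = (1 - z) ^ 2 * -Ring.inverse z := by
        linear_combination (z - 2) * hinv
      rw [hy, h2, mul_pow, ← pow_mul]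
      nth_rewrite 2 [ht]
      ring
  choose w hw using hterm
  refine ⟨∏ z ∈ primitiveRoots (p ^ (k + 1)) K, w z, ?_, ?_⟩
  · rw [Ideal.IsPrime.prod_mem_iff]
    rintro ⟨z, hz, h⟩
    exact (hw z ((mem_primitiveRoots hpos).1 hz)).1 h
  · rw [Finset.prod_congr rfl fun z hz => (hw z ((mem_primitiveRoots hpos).1 hz)).2,
      Finset.prod_mul_distrib, Finset.prod_mul_distrib, Finset.prod_pow _ (2 * m),
      prod_one_sub_primitiveRoots hζ, Finset.prod_const, hζ.card_primitiveRoots, ← pow_mul,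
      pow_add (p : K)]

/-- `P` meets the integers exactly in the multiples of `p`. After the smaller power of `p` is
cancelled, unequal exponents would put into `P` an integer prime to `p`, or the product of one with
`w`. -/
theorem padicValNat_eq_of_eq_mul [CharZero K] {P : Ideal K} [P.IsPrime] (hP : (p : K) ∈ P)
    {a b : ℕ} (ha : a ≠ 0) (hb : b ≠ 0) {w : K} (hw : w ∉ P) (h : (a : K) = b * w) :
    padicValNat p a = padicValNat p b := by
  have hp : p.Prime := Fact.out
  have hnot : ∀ c : ℕ, ¬ p ∣ c → (c : K) ∉ P := by
    intro c hc hmem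
    have hcop : IsCoprime (p : ℤ) (c : ℤ) :=
      Nat.isCoprime_iff_coprime.2 ((Nat.Prime.coprime_iff_not_dvd hp).2 hc)
    obtain ⟨u, v, huv⟩ := hcop
    have huv : (u : K) * p + v * c = 1 := by exact_mod_cast congrArg (Int.cast : ℤ → K) huv
    refine Ideal.IsPrime.ne_top ‹P.IsPrime› ((Ideal.eq_top_iff_one _).2 ?_)
    rw [← huv]
    exact P.add_mem (P.mul_mem_left _ hP) (P.mul_mem_left _ hmem)
  obtain ⟨i, a', ha', rfl⟩ := Nat.exists_eq_pow_mul_and_not_dvd ha p hp.ne_one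
  obtain ⟨j, b', hb', rfl⟩ := Nat.exists_eq_pow_mul_and_not_dvd hb p hp.ne_one
  have hval : ∀ (i c : ℕ), ¬ p ∣ c → padicValNat p (p ^ i * c) = i := by
    intro i c hc
    have hc0 : c ≠ 0 := fun h => hc (h ▸ dvd_zero p)
    rw [padicValNat.mul (pow_ne_zero _ hp.ne_zero) hc0, padicValNat.prime_pow,
      padicValNat.eq_zero_of_not_dvd hc, add_zero]
  rw [hval i a' ha', hval j b' hb']
  have hpK : ∀ n, (p : K) ^ n ≠ 0 := fun n => pow_ne_zero _ (Nat.cast_ne_zero.2 hp.ne_zero)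
  push_cast at h
  rcases lt_trichotomy i j with hij | hij | hij
  · obtain ⟨d, rfl⟩ := Nat.exists_eq_add_of_lt hij
    refine absurd ?_ (hnot a' ha')
    have : (a' : K) = p * (p ^ d * b' * w) := by
      refine mul_left_cancel₀ (hpK i) ?_
      rw [h]; ring
    rw [this]
    exact P.mul_mem_right _ hP
  · exact hij
  · obtain ⟨d, rfl⟩ := Nat.exists_eq_add_of_lt hij
    have : (b' : K) * w = p * (p ^ d * a') := by
      refine mul_left_cancel₀ (hpK j) ?_
      rw [← mul_assoc, ← h]; ring
    have hmem : (b' : K) * w ∈ P := this ▸ P.mul_mem_right _ hP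
    exact absurd hmem (fun hmem => (Ideal.IsPrime.mem_or_mem ‹_› hmem).elim (hnot b' hb') hw)

end Valuation

/-! ### The ring of algebraic integers and non-vanishing. -/

section AlgebraicIntegers

theorem exists_isPrimitiveRoot_integralClosure (n : ℕ) (hn : n ≠ 0) :
    ∃ ζ : integralClosure ℤ ℂ, IsPrimitiveRoot ζ n := by
  have h := Complex.isPrimitiveRoot_exp n hn
  exact ⟨⟨_, h.isIntegral (Nat.pos_of_ne_zero hn)⟩,
    IsPrimitiveRoot.of_map_of_injective (f := (integralClosure ℤ ℂ).val) h Subtype.val_injective⟩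

/-- If `p` were a unit, `1 / p` would be a rational algebraic integer, hence an integer. So `p` lies
in a maximal ideal. -/
theorem exists_isPrime_integralClosure (p : ℕ) [Fact p.Prime] :
    ∃ P : Ideal (integralClosure ℤ ℂ), P.IsPrime ∧ (p : integralClosure ℤ ℂ) ∈ P := by
  have hp : p.Prime := Fact.out
  have hnu : ¬ IsUnit (p : integralClosure ℤ ℂ) := by
    rintro ⟨u, hu⟩
    have h1 : (p : ℂ) * ((u⁻¹ : (integralClosure ℤ ℂ)ˣ) : integralClosure ℤ ℂ) = 1 := by
      have := congrArg (Subtype.val) (u.mul_inv)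
      rw [hu] at this
      simpa using this
    have h2 : IsIntegral ℤ ((p : ℂ)⁻¹) := by
      rw [← eq_inv_of_mul_eq_one_right h1]
      exact (Subtype.property _)
    have h3 : IsIntegral ℤ ((p : ℚ)⁻¹) := by
      rw [← isIntegral_algebraMap_iff (B := ℂ) (algebraMap ℚ ℂ).injective]
      simpa using h2
    obtain ⟨c, hc⟩ := IsIntegrallyClosed.isIntegral_iff.1 h3
    have hp0 : (p : ℚ) ≠ 0 := Nat.cast_ne_zero.2 hp.ne_zero
    have h4 : (c : ℤ) * (p : ℤ) = 1 := by
      have : (c : ℚ) * p = 1 := by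
        rw [show (c : ℚ) = (p : ℚ)⁻¹ from hc, inv_mul_cancel₀ hp0]
      exact_mod_cast this
    have := Int.isUnit_iff.1 (IsUnit.of_mul_eq_one_right _ h4)
    have := hp.two_le
    omega
  obtain ⟨M, hM, hmem⟩ := exists_max_ideal_of_mem_nonunits hnu
  exact ⟨M, hM.isPrime, hmem⟩

/-- On the unit circle every term is `2 - 2 Re (z ^ a) ≥ 0`, and the term with voltage `1` vanishes
only at `z = 1`. -/
theorem laplaceSymbol_ne_zero {ι : Type} [Fintype ι] {α : ι → ℕ} (hα : ∃ i, α i = 1)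
    {N : ℕ} (hN : N ≠ 0) {z : integralClosure ℤ ℂ} (hz : z ^ N = 1) (hz1 : z ≠ 1) :
    laplaceSymbol α z ≠ 0 := by
  intro h0
  have hzC : (z : ℂ) ^ N = 1 := by exact_mod_cast congrArg Subtype.val hz
  have hnorm : ‖(z : ℂ)‖ = 1 := Complex.norm_eq_one_of_pow_eq_one hzC hN
  have hinv : ((Ring.inverse z : integralClosure ℤ ℂ) : ℂ) = (z : ℂ)⁻¹ := by
    have := congrArg Subtype.val (Ring.mul_inverse_cancel z (IsUnit.of_pow_eq_one hz hN))
    exact eq_inv_of_mul_eq_one_right (by simpa using this)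
  have hre : ∀ a : ℕ, (2 - (z : ℂ) ^ a - (z : ℂ)⁻¹ ^ a).re = 2 - 2 * ((z : ℂ) ^ a).re := by
    intro a
    rw [inv_pow, Complex.sub_re, Complex.sub_re, Complex.inv_re,
      Complex.normSq_eq_norm_sq, norm_pow, hnorm]
    simp
    ring
  have hle : ∀ a : ℕ, 0 ≤ 2 - 2 * ((z : ℂ) ^ a).re := by
    intro a
    have := Complex.re_le_norm ((z : ℂ) ^ a)
    rw [norm_pow, hnorm, one_pow] at this
    linarith
  have hsum : ∑ i, (2 - 2 * ((z : ℂ) ^ α i).re) = 0 := by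
    have hcoe : ∀ a : ℕ, ((2 - z ^ a - Ring.inverse z ^ a : integralClosure ℤ ℂ) : ℂ)
        = 2 - (z : ℂ) ^ a - (z : ℂ)⁻¹ ^ a := by
      intro a
      rw [← hinv]
      rfl
    have := congrArg (fun x : integralClosure ℤ ℂ => (x : ℂ).re) h0
    simp only [laplaceSymbol, AddSubmonoidClass.coe_finsetSum, Complex.re_sum, hcoe, hre] at this
    exact this
  obtain ⟨i, hi⟩ := hα
  have h1 := (Finset.sum_eq_zero_iff_of_nonneg fun i _ => hle (α i)).1 hsum i (Finset.mem_univ i)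
  rw [hi, pow_one] at h1
  have hre1 : (z : ℂ).re = 1 := by linarith
  have him : (z : ℂ).im = 0 := by
    have := Complex.sq_norm_sub_sq_re (z : ℂ)
    rw [hnorm, hre1] at this
    exact pow_eq_zero_iff two_ne_zero |>.1 (by linarith)
  exact hz1 (Subtype.ext (Complex.ext (by simpa using hre1) (by simpa using him)))

end AlgebraicIntegers

/-- Needed because `padicValNat` is additive on products of non-zero numbers only. -/
theorem numSpanningTrees_cayley_ne_zero {ι : Type} [Fintype ι] {α : ι → ℕ} (hα : ∃ i, α i = 1)
    (N : ℕ) [NeZero N] : (cayley N α).numSpanningTrees ≠ 0 := by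
  classical
  obtain ⟨ζ, hζ⟩ := exists_isPrimitiveRoot_integralClosure N (NeZero.ne N)
  have h := card_mul_numSpanningTrees_cayley α hζ
  intro h0
  rw [h0, Nat.cast_zero, mul_zero, eq_comm, Finset.prod_eq_zero_iff] at h
  obtain ⟨z, hz, h⟩ := h
  rw [Finset.mem_erase, Polynomial.mem_nthRootsFinset (Nat.pos_of_ne_zero (NeZero.ne N))] at hz
  exact laplaceSymbol_ne_zero hα (NeZero.ne N) hz.2 hz.1 h

theorem padicValNat_numSpanningTrees_cayley_succ {p : ℕ} [Fact p.Prime] {ι : Type} [Fintype ι]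
    {α : ι → ℕ} (hα1 : ∃ i, α i = 1) {m μ : ℕ}
    (hα : ∀ (K : Type) [CommRing K] (z : K), IsUnit z →
      ∃ y, laplaceSymbol α z = p ^ μ * ((2 - z - Ring.inverse z) ^ m + p * y))
    {n : ℕ} (hn : 2 * m < (p ^ (n + 1)).totient) :
    padicValNat p (cayley (p ^ (n + 1)) α).numSpanningTrees + 1
      = padicValNat p (cayley (p ^ n) α).numSpanningTrees
        + (μ * (p ^ (n + 1)).totient + 2 * m) := by
  have hp : p.Prime := Fact.out
  obtain ⟨ζ, hζ⟩ := exists_isPrimitiveRoot_integralClosure (p ^ (n + 1)) (NeZero.ne _)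
  obtain ⟨P, hP, hmem⟩ := exists_isPrime_integralClosure p
  obtain ⟨w, hw, h⟩ := prod_laplaceSymbol_eq hmem (hα _) hζ hn
  have hstep := prime_mul_numSpanningTrees_cayley α hζ
  rw [h, ← mul_assoc] at hstep
  have h1 := numSpanningTrees_cayley_ne_zero hα1 (p ^ (n + 1))
  have h0 := numSpanningTrees_cayley_ne_zero hα1 (p ^ n)
  have hpow := pow_ne_zero (μ * (p ^ (n + 1)).totient + 2 * m) hp.ne_zero
  have := padicValNat_eq_of_eq_mul hmem (mul_ne_zero hp.ne_zero h1) (mul_ne_zero h0 hpow) hw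
    (by push_cast; exact hstep)
  rw [padicValNat.mul hp.ne_zero h1, padicValNat.mul h0 hpow, padicValNat.prime_pow,
    padicValNat_self] at this
  omega

end SerreGraph

/-! ### Coverings between Cayley graphs and their deck groups. -/

namespace SerreGraph

section Cayley

variable {ι : Type} [Finite ι] (α : ι → ℕ)

/-- Reduction modulo a divisor, as a morphism between Cayley graphs of cyclic groups. -/
def cayleyProj {M N : ℕ} [NeZero M] [NeZero N] (h : M ∣ N) : Hom (cayley N α) (cayley M α) where
  onV := ZMod.castHom h (ZMod M)
  onE e := ((ZMod.castHom h (ZMod M) e.1.1, e.1.2), e.2)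
  onE_bar _ := rfl
  s_onE := by
    rintro ⟨⟨u, i⟩, b⟩
    cases b
    · change (ZMod.castHom h (ZMod M)) u + (α i : ZMod M)
        = ZMod.castHom h (ZMod M) (u + (α i : ZMod N))
      rw [map_add, map_natCast]
    · rfl
  t_onE := by
    rintro ⟨⟨u, i⟩, b⟩
    cases b
    · rfl
    · change (ZMod.castHom h (ZMod M)) u + (α i : ZMod M)
        = ZMod.castHom h (ZMod M) (u + (α i : ZMod N))
      rw [map_add, map_natCast]

variable {α} {N : ℕ} [NeZero N]

/-- An edge of a Cayley graph is determined by its source and its label. -/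
theorem cayley_edge_ext {e e' : (cayley N α).E} (hs : (cayley N α).s e = (cayley N α).s e')
    (hi : e.1.2 = e'.1.2) (hb : e.2 = e'.2) : e = e' := by
  obtain ⟨⟨u, i⟩, b⟩ := e
  obtain ⟨⟨u', i'⟩, b'⟩ := e'
  change i = i' at hi
  change b = b' at hb
  subst hi hb
  have hu : u = u' := by
    cases b
    · exact add_right_cancel (b := (α i : ZMod N)) hs
    · exact hs
  rw [hu]

theorem exists_cayley_edge (v : ZMod N) (i : ι) (b : Bool) :
    ∃ e : (cayley N α).E, (cayley N α).s e = v ∧ e.1.2 = i ∧ e.2 = b := by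
  cases b
  · exact ⟨((v - (α i : ZMod N), i), false), sub_add_cancel v (α i : ZMod N), rfl, rfl⟩
  · exact ⟨((v, i), true), rfl, rfl, rfl⟩

/-- The edges starting at any vertex correspond to the pairs of an index and a direction, and `f`
keeps these labels. -/
theorem isCovering_of_label {M : ℕ} [NeZero M] {f : Hom (cayley N α) (cayley M α)}
    (hsurj : Function.Surjective f.onV) (hi : ∀ e, (f.onE e).1.2 = e.1.2)
    (hb : ∀ e, (f.onE e).2 = e.2) : f.IsCovering := by
  refine ⟨hsurj, fun v => ⟨fun e he => ?_, fun e he e' he' h => ?_, fun e he => ?_⟩⟩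
  · exact (f.s_onE e).trans (congrArg f.onV he)
  · exact cayley_edge_ext (he.trans he'.symm) (by rw [← hi e, h, hi e']) (by rw [← hb e, h, hb e'])
  · obtain ⟨e', h1, h2, h3⟩ := exists_cayley_edge (α := α) v e.1.2 e.2
    refine ⟨e', h1, cayley_edge_ext ?_ ((hi e').trans h2) ((hb e').trans h3)⟩
    exact (f.s_onE e').trans ((congrArg f.onV h1).trans (Eq.symm he))

theorem cayley_connected (hα : ∃ i, α i = 1) : (cayley N α).Connected := by
  obtain ⟨i, hi⟩ := hα
  refine ⟨⟨(0 : ZMod N)⟩, ?_⟩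
  have hstep : ∀ (v : ZMod N) (k : ℕ), Relation.ReflTransGen
      (fun a b => ∃ e ∈ Set.univ, (cayley N α).s e = a ∧ (cayley N α).t e = b)
      v (v + (k : ZMod N)) := by
    intro v k
    induction k with
    | zero =>
      rw [Nat.cast_zero, add_zero]
      exact Relation.ReflTransGen.refl
    | succ k ih =>
      refine ih.tail ⟨((v + k, i), true), trivial, rfl, ?_⟩
      change v + (k : ZMod N) + (α i : ZMod N) = v + ((k + 1 : ℕ) : ZMod N)
      rw [hi]
      push_cast
      ring
  intro (v : ZMod N) (w : ZMod N)
  have := hstep v (w - v).val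
  rwa [ZMod.natCast_zmod_val, add_sub_cancel] at this

/-- The translation of a Cayley graph by `g`, as a pair of permutations. -/
def translation (α : ι → ℕ) (g : ZMod N) :
    Equiv.Perm (cayley N α).V × Equiv.Perm (cayley N α).E :=
  ((Equiv.addLeft g : Equiv.Perm (ZMod N)),
    (((Equiv.addLeft g).prodCongr (Equiv.refl ι)).prodCongr (Equiv.refl Bool) :
      Equiv.Perm ((ZMod N × ι) × Bool)))

theorem translation_mem_deckGroup {M : ℕ} [NeZero M] [Subsingleton (cayley M α).V]
    {f : Hom (cayley N α) (cayley M α)}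
    (hi : ∀ e, (f.onE e).1.2 = e.1.2) (hb : ∀ e, (f.onE e).2 = e.2) (g : ZMod N) :
    translation α g ∈ f.deckGroup := by
  refine ⟨fun _ => rfl, ?_, fun _ => Subsingleton.elim _ _, fun e => ?_⟩
  · rintro ⟨⟨u, i⟩, b⟩
    cases b
    · exact add_assoc g u (α i : ZMod N)
    · rfl
  · exact cayley_edge_ext (Subsingleton.elim _ _) ((hi _).trans (hi e).symm)
      ((hb _).trans (hb e).symm)

/-- A deck transformation keeps labels because `f` does, hence commutes with the steps `v ↦ v + α
i`. A step by `1` reaches every vertex from `0`. -/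
theorem eq_translation_of_mem_deckGroup {M : ℕ} [NeZero M]
    {f : Hom (cayley N α) (cayley M α)} (hα : ∃ i, α i = 1)
    (hi : ∀ e, (f.onE e).1.2 = e.1.2) (hb : ∀ e, (f.onE e).2 = e.2)
    {σ : Equiv.Perm (cayley N α).V × Equiv.Perm (cayley N α).E} (hσ : σ ∈ f.deckGroup) :
    σ = translation α (σ.1 (0 : ZMod N)) := by
  obtain ⟨h1, h2, -, h4⟩ := hσ
  have hi' : ∀ e, (σ.2 e).1.2 = e.1.2 := fun e => by rw [← hi, h4, hi]
  have hb' : ∀ e, (σ.2 e).2 = e.2 := fun e => by rw [← hb, h4, hb]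
  let τ : ZMod N → ZMod N := σ.1
  have hadd : ∀ (v : ZMod N) (i : ι), τ (v + (α i : ZMod N)) = τ v + (α i : ZMod N) := by
    intro v i
    have hE : σ.2 ((v, i), true) = ((τ v, i), true) :=
      cayley_edge_ext (h2 _) (hi' _) (hb' _)
    have h := h2 ((v, i), false)
    have hE' := h1 ((v, i), true)
    rw [hE] at hE'
    exact h.symm.trans (congrArg (cayley N α).s hE')
  obtain ⟨i, hαi⟩ := hα
  have hV : ∀ v : ZMod N, τ v = τ 0 + v := by
    intro v
    have : ∀ k : ℕ, τ (k : ZMod N) = τ 0 + (k : ZMod N) := by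
      intro k
      induction k with
      | zero => simp
      | succ k ih =>
        have := hadd k i
        rw [hαi, ih, Nat.cast_one] at this
        rw [Nat.cast_succ, ← add_assoc]
        exact this
    have h := this v.val
    rwa [ZMod.natCast_zmod_val] at h
  refine Prod.ext (Equiv.ext hV) (Equiv.ext fun e => ?_)
  refine cayley_edge_ext ?_ (hi' e) (hb' e)
  refine (h2 e).trans ((hV _).trans ?_)
  obtain ⟨⟨u, i⟩, b⟩ := e
  cases b
  · exact (add_assoc (τ 0) u (α i : ZMod N)).symm
  · rfl

theorem isGaloisCovering_of_label {M : ℕ} [NeZero M] [Subsingleton (cayley M α).V]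
    {f : Hom (cayley N α) (cayley M α)} (hα : ∃ i, α i = 1)
    (hi : ∀ e, (f.onE e).1.2 = e.1.2) (hb : ∀ e, (f.onE e).2 = e.2) :
    f.IsGaloisCovering (Multiplicative (ZMod N)) := by
  refine ⟨isCovering_of_label (fun w => ⟨(0 : ZMod N), Subsingleton.elim _ _⟩) hi hb,
    fun (v w : ZMod N) _ => ⟨translation α (w - v), translation_mem_deckGroup hi hb _,
      sub_add_cancel w v⟩, ⟨MulEquiv.symm (MulEquiv.ofBijective
        (⟨⟨fun g => ⟨translation α g.toAdd, translation_mem_deckGroup hi hb _⟩, ?_⟩, ?_⟩ :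
          Multiplicative (ZMod N) →* f.deckGroup) ⟨?_, ?_⟩)⟩⟩
  · refine Subtype.ext (Prod.ext (Equiv.ext fun v : ZMod N => zero_add v) (Equiv.ext ?_))
    rintro ⟨⟨u, i⟩, b⟩
    exact congrArg (fun x : ZMod N => ((x, i), b)) (zero_add u)
  · intro g h
    refine Subtype.ext (Prod.ext (Equiv.ext fun v : ZMod N => add_assoc g.toAdd h.toAdd v)
      (Equiv.ext ?_))
    rintro ⟨⟨u, i⟩, b⟩
    exact congrArg (fun x : ZMod N => ((x, i), b)) (add_assoc g.toAdd h.toAdd u)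
  · intro g h hgh
    have := congrArg (fun σ : f.deckGroup => σ.1.1 (0 : ZMod N)) hgh
    exact (add_zero g.toAdd).symm.trans (Eq.trans this (add_zero h.toAdd))
  · rintro ⟨σ, hσ⟩
    exact ⟨Multiplicative.ofAdd (α := ZMod N) (σ.1 (0 : ZMod N)),
      Subtype.ext (eq_translation_of_mem_deckGroup hα hi hb hσ).symm⟩

end Cayley

end SerreGraph

/-! ### The tower and its Iwasawa invariants. -/

namespace GraphTower

open SerreGraph

/-- The tower of Cayley graphs of the groups `ℤ/pⁿ`. -/
def cayleyTower (p : ℕ) [NeZero p] {ι : Type} [Finite ι] (α : ι → ℕ) : GraphTower where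
  X n := cayley (p ^ n) α
  proj n := cayleyProj α (pow_dvd_pow p n.le_succ)

variable {p : ℕ} {ι : Type} {α : ι → ℕ}

theorem cayleyTower_toBase_label [NeZero p] [Finite ι] (n : ℕ) (e : (cayley (p ^ n) α).E) :
    (((cayleyTower p α).toBase n).onE e).1.2 = e.1.2 ∧
      (((cayleyTower p α).toBase n).onE e).2 = e.2 := by
  induction n with
  | zero => exact ⟨rfl, rfl⟩
  | succ n ih => exact ih (((cayleyTower p α).proj n).onE e)

theorem subsingleton_zmod_pow_zero : Subsingleton (ZMod (p ^ 0)) := by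
  rw [pow_zero]
  infer_instance

theorem isUnramifiedZpCovering_cayleyTower [NeZero p] [Finite ι] (hα : ∃ i, α i = 1) :
    (cayleyTower p α).IsUnramifiedZpCovering p where
  connected _ := cayley_connected hα
  covering n := isCovering_of_label
    (ZMod.castHom_surjective (pow_dvd_pow p n.le_succ)) (fun _ => rfl) (fun _ => rfl)
  galois n := by
    have : Subsingleton (cayley (p ^ 0) α).V := subsingleton_zmod_pow_zero (p := p)
    exact isGaloisCovering_of_label (f := (cayleyTower p α).toBase n) hα
      (fun e => (cayleyTower_toBase_label n e).1) (fun e => (cayleyTower_toBase_label n e).2)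

theorem hasIwasawaInvariants_cayleyTower [Fact p.Prime] [Fintype ι] (hα1 : ∃ i, α i = 1)
    {m μ : ℕ} (hm : 1 ≤ m)
    (hα : ∀ (K : Type) [CommRing K] (z : K), IsUnit z →
      ∃ y, laplaceSymbol α z = p ^ μ * ((2 - z - Ring.inverse z) ^ m + p * y)) :
    (cayleyTower p α).HasIwasawaInvariants p (2 * m - 1) μ := by
  have hp : p.Prime := Fact.out
  let κ : ℕ → ℕ := fun n => padicValNat p (cayley (p ^ n) α).numSpanningTrees
  -- Chosen so that `2 * m < n < p ^ n ≤ φ(p ^ (n + 1))` from `n₀` on; `ν` is then fixed by the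
  -- value at `n₀`.
  let n₀ := 2 * m + 1
  have htot : ∀ n, (p ^ (n + 1)).totient = p ^ n * (p - 1) := fun n => by
    rw [Nat.totient_prime_pow_succ hp]
  have hlarge : ∀ n, n₀ ≤ n → 2 * m < (p ^ (n + 1)).totient := by
    intro n hn
    rw [htot]
    calc 2 * m < n := hn
      _ < p ^ n := Nat.lt_pow_self hp.one_lt
      _ ≤ p ^ n * (p - 1) := Nat.le_mul_of_pos_right _ (Nat.sub_pos_of_lt hp.one_lt)
  have hlam : ((2 * m - 1 : ℕ) : ℤ) = 2 * m - 1 := by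
    push_cast [Nat.cast_sub (show 1 ≤ 2 * m by omega)]
    ring
  refine ⟨κ n₀ - (2 * m - 1 : ℕ) * n₀ - μ * (p : ℤ) ^ n₀,
    Filter.eventually_atTop.2 ⟨n₀, fun n hn => ?_⟩⟩
  change (κ n : ℤ) = _
  induction n, hn using Nat.le_induction with
  | base => ring
  | succ n hn ih =>
    have hstep := padicValNat_numSpanningTrees_cayley_succ hα1 hα (hlarge n hn)
    have hstep : (κ (n + 1) : ℤ) + 1 = κ n + (μ * (p ^ n * (p - 1)) + 2 * m) := by
      rw [htot] at hstep
      have hp1 : ((p - 1 : ℕ) : ℤ) = p - 1 := by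
        rw [Nat.cast_sub hp.one_le, Nat.cast_one]
      rw [← hp1]
      exact_mod_cast hstep
    rw [hlam] at ih ⊢
    push_cast at ih ⊢
    linear_combination hstep + ih

end GraphTower

theorem theorem1p1 (p : ℕ) (hp : p.Prime) (lam mu : ℕ) (hlam : Odd lam) :
    ∃ T : GraphTower,
      T.IsUnramifiedZpCovering p ∧ T.HasIwasawaInvariants p lam mu ∧ (T.X 0).IsBouquet := by
  have : Fact p.Prime := ⟨hp⟩
  obtain ⟨k, rfl⟩ := hlam
  obtain ⟨ι, _, α, hα1, hα⟩ :=
    -- `2 * (k + 1) - 1 = 2 * k + 1` is the prescribed odd number.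
    SerreGraph.exists_laplaceSymbol_eq hp.pos (m := k + 1) (Nat.le_add_left 1 k) mu
  refine ⟨GraphTower.cayleyTower p α, GraphTower.isUnramifiedZpCovering_cayleyTower hα1,
    GraphTower.hasIwasawaInvariants_cayleyTower hα1 (Nat.le_add_left 1 k) hα, ?_⟩
  change Nat.card (ZMod (p ^ 0)) = 1
  rw [Nat.card_zmod, pow_zero]
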